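/- \textbf{Setting.} Let $n_a,n_b,n_y,n_u,p,q\in\mathbb N$, and let $(\Omega,P)$ be a probability space. The data-generating system is $$y_k=\phi(x_k)\theta_b^*+\delta(x_k)+e_k,\qquad k\ge 0,\qquad x_k=\mathrm{vec}(y_{k-1},\dots,y_{k-n_a},u_k,\dots,u_{k-n_b})\in\mathbb R^{n_x},$$ with $\phi:\mathbb R^{n_x}\to\mathbb R^{n_y\times p}$ the regressor of the baseline model, $\theta_b^*\in\mathbb R^p$ the physically true parameters and $\delta:\mathbb R^{n_x}\to\mathbb R^{n_y}$ the unmodeled terms. The noise $(e_k)_{k\ge0}$ is white: i.i.d., zero mean, finite variance. The input $u$ is quasi-stationary: $\sup_k E\|u_k\|^2<\infty$, and $\lim_N\frac1N\sum_{k<N}E[u_ku_{k-\tau}^\top]$ exists for every $\tau$; moreover, with probability 1, $\sup_N\frac1N\sum_{k<N}\|u_k\|^2<\infty$. The noise is independent of the input and of the initial outputs $y_{-1},\dots,y_{-n_a}$, jointly. \textbf{Model.} Let $f_{\theta_a}:\mathbb R^{n_x}\to\mathbb R^{n_y}$, $\theta_a\in\mathbb R^q$, be a parametrized learning component. For regressors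 $x_0,\dots,x_{N-1}$ let $\Phi$ and $F_{\theta_a}$ be the stacked $\phi(x_i)$ and $f_{\theta_a}(x_i)$, $\theta_{aux}^N(\theta_a)=(\Phi^\top\Phi)^{-1}\Phi^\top F_{\theta_a}$, and $\hat Y_N(\theta)=\Phi\theta_b+F_{\theta_a}-\Phi\theta^N_{aux}(\theta_a)$ for $\theta=(\theta_b,\theta_a)$. With the stacked outputs $Y$, the cost on the data $D_N=((x_i,y_i))_{i<N}$ is $V_{D_N}(\theta)=\frac1N\|Y-\hat Y_N(\theta)\|_2^2$. Let $\Theta\subset\mathbb R^{p+q}$ be compact. Two parameters are equivalent if their costs coincide on every finite data set with $\Phi$ of full column rank. $\Theta^*$ is the set of $\theta\in\Theta$ for which $M_\theta$ is the true system: there is $c\in\mathbb R^p$ with $\theta_{aux}^N(\theta_a)\to c$ with probability 1 and $\phi(x)\theta_b+f_{\theta_a}(x)-\phi(x)c=\phi(x)\theta_b^*+\delta(x)$ for all $x$. \textbf{Theorem (Consistency).} Assume: (i) (stable system) for every $\rho>0$ there are $C\ge0$, $\lambda\in[0,1)$ such that for all $k_o\ge0$, any two solutions $y,\tilde y$ of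 the system with the same $(u_k,e_k)$, started at time $k_o$ from deterministic regressors less than $\rho$ apart, satisfy $E\|y_k-\tilde y_k\|_2^4<C\lambda^{k-k_o}$ for all $k\ge k_o$; (ii) (stable predictor) on an open neighbourhood $\breve\Theta$ of $\Theta$, for every fixed value $c$ of the auxiliary parameter, the predictor $\gamma(\theta,x)=\phi(x)\theta_b+f_{\theta_a}(x)-\phi(x)c$ is differentiable in $\theta$, and there are $C\ge0$, $\lambda\in[0,1)$ such that for all $\theta\in\breve\Theta$, all $k\ge0$ and any two data sequences $(u,y),(\tilde u,\tilde y)$, with corresponding regressors $x_k,\tilde x_k$, both $\|\gamma(\theta,x_k)-\gamma(\theta,\tilde x_k)\|$ and $\|\partial_\theta\gamma(\theta,x_k)-\partial_\theta\gamma(\theta,\tilde x_k)\|$ are at most $C\sum_{i=-n}^k\lambda^{k-i}(\|u_i-\tilde u_i\|+\|y_i-\tilde y_i\|)$, $n=\max(n_a,n_b)$, and $\|\gamma(\theta,0)\|\le C$; (iii) (data orthogonality) with probability 1, $\frac1N\sum_{i<N}\phi(x_i)^\top\delta(x_i)\to0$; (iv) (identifiability and weak persistency of excitation) $\phi(\cdot)\theta_b^{(1)}=\phi(\cdot)\theta_b^{(2)}$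 implies $\theta_b^{(1)}=\theta_b^{(2)}$; with probability 1, $\liminf_N\frac1N\|\Phi(\theta_b^{(1)}-\theta_b^{(2)})\|^2>0$ whenever $\phi(\cdot)\theta_b^{(1)}\ne\phi(\cdot)\theta_b^{(2)}$; and with probability 1, $\liminf_N\frac1N\|\hat Y_N(\theta_1)-\hat Y_N(\theta_2)\|^2>0$ for all non-equivalent $\theta_1,\theta_2\in\Theta$; (v) $\Theta^*\neq\varnothing$. Then, with probability 1, minimizers of $V_{D_N}$ over $\Theta$ exist for every $N$, and every sequence $\hat\theta^N=(\hat\theta_b^N,\hat\theta_a^N)\in\arg\min_{\theta\in\Theta}V_{D_N}(\theta)$ satisfies $$\mathrm{dist}(\hat\theta^N,\Theta^*)\to0,\qquad \hat\theta_b^N\to\theta_b^*\qquad(N\to\infty).$$ -/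

import Mathlib

open MeasureTheory ProbabilityTheory Filter Topology
open scoped Matrix ENNReal

noncomputable section

namespace OrthAug

/-- `ℝⁿ` with the Euclidean norm. -/
abbrev Vec (n : ℕ) := EuclideanSpace ℝ (Fin n)

/-- The regressor space `ℝ^{n_x}`: `na` lagged outputs in `ℝ^{ny}` and the current and `nb` lagged
inputs in `ℝ^{nu}`, with the Euclidean norm. -/
abbrev Reg (na nb ny nu : ℕ) := EuclideanSpace ℝ ((Fin na × Fin ny) ⊕ (Fin (nb + 1) × Fin nu))

/-- The parameter space of `θ = vec(θ_b, θ_a)`. -/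
abbrev Par (p q : ℕ) := Vec p × Vec q

/-- The regressor `x_k = vec(y_{k-1}, …, y_{k-na}, u_k, …, u_{k-nb})`. -/
def reg {ny nu : ℕ} (na nb : ℕ) (y : ℤ → Vec ny) (u : ℤ → Vec nu) (k : ℤ) : Reg na nb ny nu :=
  WithLp.toLp 2 (Sum.elim (fun s => y (k - 1 - (s.1 : ℤ)) s.2) (fun s => u (k - (s.1 : ℤ)) s.2))

/-- The regressor that follows `x` when the output is `y` and the next input is `u`. -/
def nextReg {na nb ny nu : ℕ} (x : Reg na nb ny nu) (y : Vec ny) (u : Vec nu) : Reg na nb ny nu :=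
  WithLp.toLp 2 (Sum.elim
    (fun s => if s.1.val = 0 then y s.2
      else x (Sum.inl (⟨s.1.val - 1, lt_of_le_of_lt (Nat.sub_le _ _) s.1.isLt⟩, s.2)))
    (fun s => if s.1.val = 0 then u s.2
      else x (Sum.inr (⟨s.1.val - 1, lt_of_le_of_lt (Nat.sub_le _ _) s.1.isLt⟩, s.2))))

/-! ### Model structure -/

/-- The two components of the model: the regressor matrix function `φ` of the baseline model, and
the (arbitrary) parametrized learning component `f_{θ_a}`. -/
structure Components (na nb ny nu p q : ℕ) where
  phi : Reg na nb ny nu → Matrix (Fin ny) (Fin p) ℝ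
  learn : Vec q → Reg na nb ny nu → Vec ny

namespace Components

variable {na nb ny nu p q : ℕ} (M : Components na nb ny nu p q)

/-- The baseline output `φ(x) θ_b`. -/
def base (b : Vec p) (x : Reg na nb ny nu) : Vec ny := WithLp.toLp 2 (M.phi x *ᵥ b.ofLp)

/-- The stacked regressor matrix `Φ` of the data `x_0, …, x_{N-1}`. -/
def Phi {N : ℕ} (x : Fin N → Reg na nb ny nu) : Matrix (Fin N × Fin ny) (Fin p) ℝ :=
  Matrix.of fun s l => M.phi (x s.1) s.2 l

/-- The stacked learning component `F_{θ_a}`. -/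
def F {N : ℕ} (x : Fin N → Reg na nb ny nu) (a : Vec q) : Fin N × Fin ny → ℝ :=
  fun s => M.learn a (x s.1) s.2

/-- `θ_aux = (Φᵀ Φ)⁻¹ Φᵀ F_{θ_a}`. -/
def thetaAux {N : ℕ} (x : Fin N → Reg na nb ny nu) (a : Vec q) : Vec p :=
  WithLp.toLp 2 (((M.Phi x)ᵀ * M.Phi x)⁻¹ *ᵥ ((M.Phi x)ᵀ *ᵥ M.F x a))

/-- The stacked prediction `Ŷ = Φ θ_b + (F_{θ_a} - Φ θ_aux)` of the orthogonal parametrization. -/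
def pred {N : ℕ} (x : Fin N → Reg na nb ny nu) (θ : Par p q) : Fin N × Fin ny → ℝ :=
  M.Phi x *ᵥ θ.1.ofLp + (M.F x θ.2 - M.Phi x *ᵥ (M.thetaAux x θ.2).ofLp)

/-- The cost `V_D(θ) = (1/N) ‖Y - Ŷ‖²` on the data `D = ((x_i, y_i))_{i<N}`. -/
def cost {N : ℕ} (x : Fin N → Reg na nb ny nu) (y : Fin N → Vec ny) (θ : Par p q) : ℝ :=
  (N : ℝ)⁻¹ * ∑ s : Fin N × Fin ny, (y s.1 s.2 - M.pred x θ s) ^ 2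

/-- `V_{(·)}(θ₁) = V_{(·)}(θ₂)`: the costs agree on every data set, of any length, on which the
parametrization is defined (full column rank of `Φ`). -/
def CostEquiv (θ₁ θ₂ : Par p q) : Prop :=
  ∀ (N : ℕ) (x : Fin N → Reg na nb ny nu) (y : Fin N → Vec ny),
    (M.Phi x).rank = p → M.cost x y θ₁ = M.cost x y θ₂

/-- The one-step-ahead predictor `φ(x) θ_b + f_{θ_a}(x) - φ(x) c` of a model whose auxiliary
parameter `θ_aux` has the fixed value `c`. -/
def osa (θ : Par p q) (c : Vec p) (x : Reg na nb ny nu) : Vec ny :=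
  M.base θ.1 x + M.learn θ.2 x - M.base c x

/-- `Γ_k = ∑_{i=-n}^k λ^{k-i} (‖u_i - u'_i‖ + ‖y_i - y'_i‖)`. -/
def Gam (n : ℕ) (lam : ℝ) (y y' : ℤ → Vec ny) (u u' : ℤ → Vec nu) (k : ℕ) : ℝ :=
  ∑ i ∈ Finset.Icc (-(n : ℤ)) (k : ℤ),
    lam ^ ((k : ℤ) - i).toNat * (‖u i - u' i‖ + ‖y i - y' i‖)

/-- Stable predictor: on an open neighbourhood `U` of `Θ` the predictor is differentiable in `θ`;
it and its `θ`-derivative depend on the data with exponentially fading memory, and the predictor is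
bounded at zero data. `θ_aux` is a fixed parameter of the predictor here. -/
def StablePredictor (Θ : Set (Par p q)) : Prop :=
  ∃ U : Set (Par p q), IsOpen U ∧ Θ ⊆ U ∧ ∀ c : Vec p,
    (∀ θ ∈ U, ∀ x, DifferentiableAt ℝ (fun θ' => M.osa θ' c x) θ) ∧
    ∃ C lam : ℝ, 0 ≤ C ∧ 0 ≤ lam ∧ lam < 1 ∧ ∀ θ ∈ U, ∀ k : ℕ,
      ‖M.osa θ c (reg na nb (fun _ => 0) (fun _ => 0) k)‖ ≤ C ∧
      ∀ (y y' : ℤ → Vec ny) (u u' : ℤ → Vec nu),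
        ‖M.osa θ c (reg na nb y u k) - M.osa θ c (reg na nb y' u' k)‖
          ≤ C * Gam (max na nb) lam y y' u u' k ∧
        ‖fderiv ℝ (fun θ' => M.osa θ' c (reg na nb y u k)) θ
            - fderiv ℝ (fun θ' => M.osa θ' c (reg na nb y' u' k)) θ‖
          ≤ C * Gam (max na nb) lam y y' u u' k

end Components

/-! ### Data-generating system -/

variable {Ω : Type*}

/-- White noise: i.i.d., zero mean, finite variance. -/
structure WhiteNoise [MeasurableSpace Ω] {n : ℕ} (P : Measure Ω) (e : ℕ → Ω → Vec n) : Prop where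
  meas : ∀ k, Measurable (e k)
  indep : iIndepFun e P
  ident : ∀ k, IdentDistrib (e k) (e 0) P P
  memLp : MemLp (e 0) 2 P
  mean : ∫ ω, e 0 ω ∂P = 0

/-- Quasi-stationary signal: bounded second moments (hence bounded means and covariances), and all
time-averaged covariances `lim_N (1/N) ∑_{k<N} E[u_k u_{k-τ}ᵀ]` exist. -/
structure QuasiStationary [MeasurableSpace Ω] {n : ℕ} (P : Measure Ω) (u : ℤ → Ω → Vec n) : Prop where
  meas : ∀ k, Measurable (u k)
  memLp : ∀ k, MemLp (u k) 2 P
  bdd : ∃ C : ℝ, ∀ k, ∫ ω, ‖u k ω‖ ^ 2 ∂P ≤ C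
  cov : ∀ (τ : ℤ) (i j : Fin n), ∃ R : ℝ, Tendsto (fun N : ℕ =>
    (N : ℝ)⁻¹ * ∑ k ∈ Finset.range N, ∫ ω, u (k : ℤ) ω i * u ((k : ℤ) - τ) ω j ∂P) atTop (𝓝 R)

/-- Almost every realization of the signal has finite average power. -/
def FiniteAveragePower [MeasurableSpace Ω] {n : ℕ} (P : Measure Ω) (u : ℤ → Ω → Vec n) : Prop :=
  ∀ᵐ ω ∂P, ∃ B : ℝ, ∀ N : ℕ, ∑ k ∈ Finset.range N, ‖u (k : ℤ) ω‖ ^ 2 ≤ B * N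

/-- The regressor at time `ko + m` of `y_k = f(x_k) + e_k`, started with regressor `x0` at time `ko`
and driven by the input `u` and the noise `e`. -/
def simReg {na nb ny nu : ℕ} (f : Reg na nb ny nu → Vec ny) (u : ℤ → Vec nu) (e : ℕ → Vec ny)
    (ko : ℕ) (x0 : Reg na nb ny nu) : ℕ → Reg na nb ny nu
  | 0 => x0
  | m + 1 => nextReg (simReg f u e ko x0 m) (f (simReg f u e ko x0 m) + e (ko + m))
      (u (((ko + m + 1 : ℕ)) : ℤ))

/-- The corresponding output at time `ko + m`. -/
def simOut {na nb ny nu : ℕ} (f : Reg na nb ny nu → Vec ny) (u : ℤ → Vec nu) (e : ℕ → Vec ny)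
    (ko : ℕ) (x0 : Reg na nb ny nu) (m : ℕ) : Vec ny :=
  f (simReg f u e ko x0 m) + e (ko + m)

/-- Stable system: two trajectories with the same input and noise and with regressors `x0`, `x0'`
at time `ko`, less than `ρ` apart, approach each other exponentially in the fourth mean. -/
def StableSystem [MeasurableSpace Ω] {na nb ny nu : ℕ} (P : Measure Ω) (f : Reg na nb ny nu → Vec ny)
    (u : ℤ → Ω → Vec nu) (e : ℕ → Ω → Vec ny) : Prop :=
  ∀ ρ : ℝ, 0 < ρ → ∃ C lam : ℝ, 0 ≤ C ∧ 0 ≤ lam ∧ lam < 1 ∧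
    ∀ (ko : ℕ) (x0 x0' : Reg na nb ny nu), ‖x0 - x0'‖ < ρ → ∀ m : ℕ,
      ∫⁻ ω, ‖simOut f (fun i => u i ω) (fun i => e i ω) ko x0 m
          - simOut f (fun i => u i ω) (fun i => e i ω) ko x0' m‖ₑ ^ 4 ∂P
        < ENNReal.ofReal (C * lam ^ m)

/-- The regressor `x_k(ω)` of the observed process. -/
def dataReg {ny nu : ℕ} (na nb : ℕ) (y : ℤ → Ω → Vec ny) (u : ℤ → Ω → Vec nu) (ω : Ω) (k : ℕ) :
    Reg na nb ny nu :=
  reg na nb (fun i => y i ω) (fun i => u i ω) k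

namespace Components

variable {na nb ny nu p q : ℕ} (M : Components na nb ny nu p q)

/-- `V_{D_N}(θ)` for the observed data `D_N = ((x_i, y_i))_{i<N}`. -/
def dataCost (y : ℤ → Ω → Vec ny) (u : ℤ → Ω → Vec nu) (N : ℕ) (ω : Ω) (θ : Par p q) : ℝ :=
  M.cost (N := N) (fun i => dataReg na nb y u ω i) (fun i => y ((i : ℕ) : ℤ) ω) θ

/-- The prediction-error estimates `argmin_{θ ∈ Θ} V_{D_N}(θ)`. -/
def argminSet (Θ : Set (Par p q)) (y : ℤ → Ω → Vec ny) (u : ℤ → Ω → Vec nu) (N : ℕ) (ω : Ω) :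
    Set (Par p q) :=
  {θ | θ ∈ Θ ∧ ∀ θ' ∈ Θ, M.dataCost y u N ω θ ≤ M.dataCost y u N ω θ'}

/-- The equivalence set `Θ*`: the `θ ∈ Θ` for which the model `M_θ`, with its auxiliary parameter
`θ_aux` determined by the data as `N → ∞`, is the data-generating system. -/
def trueSet [MeasurableSpace Ω] (P : Measure Ω) (Θ : Set (Par p q)) (y : ℤ → Ω → Vec ny) (u : ℤ → Ω → Vec nu)
    (bstar : Vec p) (δ : Reg na nb ny nu → Vec ny) : Set (Par p q) :=
  {θ | θ ∈ Θ ∧ ∃ c : Vec p,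
    (∀ᵐ ω ∂P, Tendsto (fun N : ℕ => M.thetaAux (N := N) (fun i => dataReg na nb y u ω i) θ.2)
      atTop (𝓝 c)) ∧
    ∀ x, M.osa θ c x = M.base bstar x + δ x}

/-- Orthogonality of the regressor and the unmodeled terms on the data:
`(1/N) ∑_{i<N} φ(x_i)ᵀ δ(x_i) → 0` with probability one. -/
def DataOrthogonal [MeasurableSpace Ω] (P : Measure Ω) (y : ℤ → Ω → Vec ny) (u : ℤ → Ω → Vec nu)
    (δ : Reg na nb ny nu → Vec ny) : Prop :=
  ∀ᵐ ω ∂P, Tendsto (fun N : ℕ => (N : ℝ)⁻¹ • ∑ i ∈ Finset.range N,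
    (M.phi (dataReg na nb y u ω i))ᵀ *ᵥ (δ (dataReg na nb y u ω i)).ofLp) atTop (𝓝 0)

/-- Identifiability of the baseline: `φ(·) b₁ = φ(·) b₂` implies `b₁ = b₂`. -/
def BaselineIdentifiable : Prop :=
  ∀ b₁ b₂ : Vec p, (∀ x, M.base b₁ x = M.base b₂ x) → b₁ = b₂

/-- Weak persistency of excitation for the baseline: with probability one, different baseline
functions have different outputs on the data, in mean square as `N → ∞`. -/
def BaselineExcited [MeasurableSpace Ω] (P : Measure Ω) (y : ℤ → Ω → Vec ny) (u : ℤ → Ω → Vec nu) : Prop :=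
  ∀ᵐ ω ∂P, ∀ b₁ b₂ : Vec p, (∃ x, M.base b₁ x ≠ M.base b₂ x) →
    ∃ c : ℝ, 0 < c ∧ ∀ᶠ N : ℕ in atTop, c ≤ (N : ℝ)⁻¹ * ∑ i ∈ Finset.range N,
      ‖M.base b₁ (dataReg na nb y u ω i) - M.base b₂ (dataReg na nb y u ω i)‖ ^ 2

/-- Weak persistency of excitation for the model set: with probability one, non-equivalent models
in `Θ` have different predictions on the data, in mean square as `N → ∞`. -/
def ModelsExcited [MeasurableSpace Ω] (P : Measure Ω) (Θ : Set (Par p q)) (y : ℤ → Ω → Vec ny)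
    (u : ℤ → Ω → Vec nu) : Prop :=
  ∀ᵐ ω ∂P, ∀ θ₁ ∈ Θ, ∀ θ₂ ∈ Θ, ¬ M.CostEquiv θ₁ θ₂ →
    ∃ c : ℝ, 0 < c ∧ ∀ᶠ N : ℕ in atTop, c ≤ (N : ℝ)⁻¹ * ∑ s : Fin N × Fin ny,
      (M.pred (N := N) (fun i => dataReg na nb y u ω i) θ₁ s
        - M.pred (N := N) (fun i => dataReg na nb y u ω i) θ₂ s) ^ 2

end Components

end OrthAug

end

/-!
The least-squares residual in the parametrization makes every prediction of the form
`Φ θ_b + (1 - Π) G(θ)`, where `Π` is the projection onto the range of `Φ` and `G(θ)` stacks the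
predictor with auxiliary parameter `0`. The cost is compared with the cost of one true parameter
`θ₀`, for one realization at a time.

**Power.** The observed regressors have almost surely finite average power, although nothing is
assumed about the initial outputs beyond measurability (`StableSystem.average_power`). Stability in
the mean between deterministic regressors, applied along a chain of unit steps, makes distant
trajectories contract at large scales. The true system equals a stable predictor, hence is
Lipschitz, so input and noise move a trajectory by an amount that does not depend on its initial
regressor; therefore the contraction passes to the free system, which is deterministic, and back
from there to every realization of the driven one.

**Noise.** A strong law for martingale transforms (`ae_tendsto_average_transform`) needs only finite
average power of the weights, not moments. It makes the noise asymptotically orthogonal to the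
baseline and to the predictors for a countable dense set of parameters. The stable predictor is
equicontinuous in the parameter relative to `1 + ‖x‖` (`StablePredictor.osa_equicontinuous`), which
extends the law to all of `Θ` on one almost sure event (`ae_typical`).

**Consistency.** On this event, if minimizers converge to `θ` along a subsequence, comparison with
`θ₀` gives that the predictions of `θ` and `θ₀` agree asymptotically in mean square
(`Typical.tendsto_meanSq_pred_sub`), so `θ` and `θ₀` are equivalent by excitation. Equivalence means
that the learning components differ by one baseline function (`CostEquiv.eq_and_learn_eq`), and
then `θ` is a true parameter as well (`CostEquiv.mem_trueSet`). Finally, orthogonality of the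
unmodeled terms to the baseline identifies the baseline part of every true parameter
(`Typical.eq_of_true`).
-/

namespace OrthAug

/-! ### Regressor geometry -/

section Regressors

variable {na nb ny nu p q : ℕ}

/-- The `s`-th lagged output contained in a regressor. -/
def outBlock (z : Reg na nb ny nu) (s : Fin na) : Vec ny := WithLp.toLp 2 fun i => z (Sum.inl (s, i))

/-- The `t`-th lagged input contained in a regressor. -/
def inBlock (z : Reg na nb ny nu) (t : Fin (nb + 1)) : Vec nu :=
  WithLp.toLp 2 fun i => z (Sum.inr (t, i))

lemma norm_sq_eq_blocks (z : Reg na nb ny nu) :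
    ‖z‖ ^ 2 = ∑ s, ‖outBlock z s‖ ^ 2 + ∑ t, ‖inBlock z t‖ ^ 2 := by
  simp only [EuclideanSpace.real_norm_sq_eq, Fintype.sum_sum_type, Fintype.sum_prod_type, outBlock,
    inBlock]

lemma norm_outBlock_le (z : Reg na nb ny nu) (s : Fin na) : ‖outBlock z s‖ ≤ ‖z‖ := by
  refine le_of_sq_le_sq ?_ (norm_nonneg _)
  rw [norm_sq_eq_blocks z]
  have h1 := Finset.single_le_sum (f := fun s => ‖outBlock z s‖ ^ 2) (fun i _ => sq_nonneg _)
    (Finset.mem_univ s)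
  have h2 : 0 ≤ ∑ t, ‖inBlock z t‖ ^ 2 := Finset.sum_nonneg fun i _ => sq_nonneg _
  linarith

lemma norm_inBlock_le (z : Reg na nb ny nu) (t : Fin (nb + 1)) : ‖inBlock z t‖ ≤ ‖z‖ := by
  refine le_of_sq_le_sq ?_ (norm_nonneg _)
  rw [norm_sq_eq_blocks z]
  have h1 := Finset.single_le_sum (f := fun s => ‖inBlock z s‖ ^ 2) (fun i _ => sq_nonneg _)
    (Finset.mem_univ t)
  have h2 : 0 ≤ ∑ t, ‖outBlock z t‖ ^ 2 := Finset.sum_nonneg fun i _ => sq_nonneg _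
  linarith

lemma norm_le_sum_blocks (z : Reg na nb ny nu) :
    ‖z‖ ≤ ∑ s, ‖outBlock z s‖ + ∑ t, ‖inBlock z t‖ := by
  have ha : 0 ≤ ∑ s, ‖outBlock z s‖ := Finset.sum_nonneg fun i _ => norm_nonneg _
  have hb : 0 ≤ ∑ s, ‖inBlock z s‖ := Finset.sum_nonneg fun i _ => norm_nonneg _
  refine le_of_sq_le_sq ?_ (by positivity)
  rw [norm_sq_eq_blocks z]
  have h1 := Finset.sum_sq_le_sq_sum_of_nonneg (s := Finset.univ) (f := fun s => ‖outBlock z s‖)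
    (fun i _ => norm_nonneg _)
  have h2 := Finset.sum_sq_le_sq_sum_of_nonneg (s := Finset.univ) (f := fun s => ‖inBlock z s‖)
    (fun i _ => norm_nonneg _)
  nlinarith [mul_nonneg ha hb]

lemma norm_le_of_blocks_le {z : Reg na nb ny nu} {a : ℝ} (h1 : ∀ s, ‖outBlock z s‖ ≤ a)
    (h2 : ∀ t, ‖inBlock z t‖ ≤ a) : ‖z‖ ≤ (na + nb + 1) * a := by
  refine (norm_le_sum_blocks z).trans ?_
  have h1' := Finset.sum_le_sum fun s (_ : s ∈ Finset.univ) => h1 s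
  have h2' := Finset.sum_le_sum fun s (_ : s ∈ Finset.univ) => h2 s
  simp only [Finset.sum_const, Finset.card_univ, Fintype.card_fin, nsmul_eq_mul] at h1' h2'
  push_cast at h2'
  linarith

lemma outBlock_nextReg (x : Reg na nb ny nu) (y : Vec ny) (u : Vec nu) (s : Fin na) :
    outBlock (nextReg x y u) s = if s.val = 0 then y
      else outBlock x ⟨s.val - 1, lt_of_le_of_lt (Nat.sub_le _ _) s.isLt⟩ := by
  ext i; simp only [outBlock, nextReg, Sum.elim_inl]; split_ifs <;> rfl

lemma inBlock_nextReg (x : Reg na nb ny nu) (y : Vec ny) (u : Vec nu) (s : Fin (nb + 1)) :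
    inBlock (nextReg x y u) s = if s.val = 0 then u
      else inBlock x ⟨s.val - 1, lt_of_le_of_lt (Nat.sub_le _ _) s.isLt⟩ := by
  ext i; simp only [inBlock, nextReg, Sum.elim_inr]; split_ifs <;> rfl

lemma nextReg_sub (x x' : Reg na nb ny nu) (y y' : Vec ny) (u u' : Vec nu) :
    nextReg x y u - nextReg x' y' u' = nextReg (x - x') (y - y') (u - u') := by
  ext (s | s) <;> simp only [nextReg, PiLp.sub_apply, Sum.elim_inl, Sum.elim_inr] <;>
    split_ifs <;> rfl

lemma norm_nextReg_le (x : Reg na nb ny nu) (y : Vec ny) (u : Vec nu) :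
    ‖nextReg x y u‖ ≤ (na + nb + 1) * (‖x‖ + ‖y‖ + ‖u‖) := by
  have := norm_nonneg x
  have := norm_nonneg y
  have := norm_nonneg u
  refine norm_le_of_blocks_le (fun s => ?_) fun s => ?_
  · rw [outBlock_nextReg]
    split_ifs
    · linarith
    · linarith [norm_outBlock_le x ⟨s.val - 1, lt_of_le_of_lt (Nat.sub_le _ _) s.isLt⟩]
  · rw [inBlock_nextReg]
    split_ifs
    · linarith
    · linarith [norm_inBlock_le x ⟨s.val - 1, lt_of_le_of_lt (Nat.sub_le _ _) s.isLt⟩]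

lemma norm_nextReg_sub_le (x x' : Reg na nb ny nu) (y y' : Vec ny) (u u' : Vec nu) :
    ‖nextReg x y u - nextReg x' y' u'‖ ≤ (na + nb + 1) * (‖x - x'‖ + ‖y - y'‖ + ‖u - u'‖) := by
  rw [nextReg_sub]; exact norm_nextReg_le _ _ _

lemma reg_succ (y : ℤ → Vec ny) (u : ℤ → Vec nu) (k : ℤ) :
    reg na nb y u (k + 1) = nextReg (reg na nb y u k) (y k) (u (k + 1)) := by
  ext (s | s)
  · simp only [reg, nextReg, Sum.elim_inl]
    split_ifs with h
    · rw [h]; simp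
    · have e : k + 1 - 1 - (s.1.val : ℤ) = k - 1 - ((s.1.val - 1 : ℕ) : ℤ) := by omega
      simp only [e]
  · simp only [reg, nextReg, Sum.elim_inr]
    split_ifs with h
    · rw [h]; simp
    · have e : k + 1 - (s.1.val : ℤ) = k - ((s.1.val - 1 : ℕ) : ℤ) := by omega
      simp only [e]

/-- Every regressor is the regressor at time `0` of data sequences whose terms it bounds; the choice
is linear, so that distances of regressors bound distances of the data. -/
lemma reg_extend (z : Reg na nb ny nu) :
    reg na nb
      (fun i => if h : (-1 - i).toNat < na ∧ i < 0 then outBlock z ⟨(-1 - i).toNat, h.1⟩ else 0)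
      (fun i => if h : (-i).toNat < nb + 1 then inBlock z ⟨(-i).toNat, h⟩ else 0) 0 = z := by
  ext (s | s)
  · have h : (-1 - (0 - 1 - (s.1.val : ℤ))).toNat = s.1.val := by omega
    have h2 : (0 - 1 - (s.1.val : ℤ)) < 0 := by omega
    simp only [reg, Sum.elim_inl]
    rw [dif_pos ⟨by rw [h]; exact s.1.isLt, h2⟩]
    simp only [outBlock, h]
  · have h : (-(0 - (s.1.val : ℤ))).toNat = s.1.val := by omega
    simp only [reg, Sum.elim_inr]
    rw [dif_pos (by rw [h]; exact s.1.isLt)]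
    simp only [inBlock, h]

/-! ### The stable predictor as a function of the regressor -/

namespace Components

variable (M : Components na nb ny nu p q)

/-- The memory term of the stable predictor hypothesis at time `0` is bounded by the distance of the
regressors, for suitable data sequences that produce them. -/
lemma exists_data_gam_le (z z' : Reg na nb ny nu) : ∃ (y y' : ℤ → Vec ny) (u u' : ℤ → Vec nu),
    reg na nb y u 0 = z ∧ reg na nb y' u' 0 = z' ∧ ∀ lam : ℝ, 0 ≤ lam → lam < 1 →
      Gam (max na nb) lam y y' u u' 0 ≤ 2 * (((max na nb : ℕ) : ℝ) + 1) * ‖z - z'‖ := by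
  refine ⟨_, _, _, _, reg_extend z, reg_extend z', fun lam h0 h1 => ?_⟩
  unfold Gam
  have : ∀ i ∈ Finset.Icc (-((max na nb : ℕ) : ℤ)) ((0 : ℕ) : ℤ),
    lam ^ (((0 : ℕ) : ℤ) - i).toNat *
     (‖(if h : (-i).toNat < nb + 1 then inBlock z ⟨(-i).toNat, h⟩ else 0) -
        (if h : (-i).toNat < nb + 1 then inBlock z' ⟨(-i).toNat, h⟩ else 0)‖ +
      ‖(if h : (-1 - i).toNat < na ∧ i < 0 then outBlock z ⟨(-1 - i).toNat, h.1⟩ else 0)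
        - (if h : (-1 - i).toNat < na ∧ i < 0 then outBlock z' ⟨(-1 - i).toNat, h.1⟩ else 0)‖)
      ≤ 2 * ‖z - z'‖ := by
    intro i _
    have e1 : ‖(if h : (-i).toNat < nb + 1 then inBlock z ⟨(-i).toNat, h⟩ else 0) -
        (if h : (-i).toNat < nb + 1 then inBlock z' ⟨(-i).toNat, h⟩ else 0)‖ ≤ ‖z - z'‖ := by
      split_ifs
      · exact norm_inBlock_le (z - z') _
      · simp
    have e2 : ‖(if h : (-1 - i).toNat < na ∧ i < 0 then outBlock z ⟨(-1 - i).toNat, h.1⟩ else 0)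
        - (if h : (-1 - i).toNat < na ∧ i < 0 then outBlock z' ⟨(-1 - i).toNat, h.1⟩ else 0)‖
        ≤ ‖z - z'‖ := by
      split_ifs
      · exact norm_outBlock_le (z - z') _
      · simp
    calc _ ≤ 1 * (‖z - z'‖ + ‖z - z'‖) :=
          mul_le_mul (pow_le_one₀ h0 h1.le) (add_le_add e1 e2) (by positivity) zero_le_one
      _ = _ := by ring
  refine (Finset.sum_le_sum this).trans (le_of_eq ?_)
  rw [Finset.sum_const, Int.card_Icc, nsmul_eq_mul]
  have : (((0 : ℕ) : ℤ) + 1 - -((max na nb : ℕ) : ℤ)).toNat = max na nb + 1 := by omega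
  rw [this, Nat.cast_add, Nat.cast_one]; ring

lemma osa_eq_sub_base (θ : Par p q) (c : Vec p) (x : Reg na nb ny nu) :
    M.osa θ c x = M.osa θ 0 x - M.base c x := by
  simp [osa, base]

lemma base_add (b c : Vec p) (x : Reg na nb ny nu) : M.base (b + c) x = M.base b x + M.base c x := by
  ext i; simp [base, Matrix.mulVec_add]

variable {M} {Θ : Set (Par p q)}

/-- In terms of regressors, the stable predictor hypothesis is a Lipschitz condition on the predictor
and its parameter derivative, uniform over a neighbourhood of `Θ`. -/
lemma StablePredictor.regressor (h : M.StablePredictor Θ) :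
    ∃ U : Set (Par p q), IsOpen U ∧ Θ ⊆ U ∧ ∀ c : Vec p,
      (∀ θ ∈ U, ∀ x, DifferentiableAt ℝ (fun θ' => M.osa θ' c x) θ) ∧
      ∃ C : ℝ, 0 ≤ C ∧ ∀ θ ∈ U, ‖M.osa θ c 0‖ ≤ C ∧ ∀ x x',
        ‖M.osa θ c x - M.osa θ c x'‖ ≤ C * ‖x - x'‖ ∧
        ‖fderiv ℝ (fun θ' => M.osa θ' c x) θ - fderiv ℝ (fun θ' => M.osa θ' c x') θ‖
          ≤ C * ‖x - x'‖ := by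
  obtain ⟨U, hU, hΘU, h⟩ := h
  refine ⟨U, hU, hΘU, fun c => ⟨(h c).1, ?_⟩⟩
  obtain ⟨C, lam, hC, h0, h1, H⟩ := (h c).2
  refine ⟨C + C * (2 * (((max na nb : ℕ) : ℝ) + 1)), by positivity, fun θ hθ => ⟨?_, fun x x' => ?_⟩⟩
  · have h2 := (H θ hθ 0).1
    have h3 : reg na nb (fun _ => (0 : Vec ny)) (fun _ => (0 : Vec nu)) ((0 : ℕ) : ℤ) = 0 := by
      ext (s | s) <;> simp [reg]
    rw [h3] at h2
    have : 0 ≤ C * (2 * (((max na nb : ℕ) : ℝ) + 1)) := by positivity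
    linarith
  · obtain ⟨y, y', u, u', rfl, rfl, hG⟩ := exists_data_gam_le x x'
    have h2 := (H θ hθ 0).2 y y' u u'
    have h3 := mul_le_mul_of_nonneg_left (hG lam h0 h1) hC
    have h4 := mul_nonneg hC (norm_nonneg (reg na nb y u 0 - reg na nb y' u' 0))
    refine ⟨h2.1.trans ?_, h2.2.trans ?_⟩ <;> nlinarith

lemma StablePredictor.osa_lipschitz (h : M.StablePredictor Θ) {θ : Par p q} (hθ : θ ∈ Θ)
    (c : Vec p) :
    ∃ L : ℝ, 0 ≤ L ∧ ∀ x x', ‖M.osa θ c x - M.osa θ c x'‖ ≤ L * ‖x - x'‖ := by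
  obtain ⟨U, -, hΘU, h⟩ := h.regressor
  obtain ⟨C, hC, H⟩ := (h c).2
  exact ⟨C, hC, fun x x' => ((H θ (hΘU hθ)).2 x x').1⟩

/-- The baseline is a difference of two predictors with different auxiliary parameters. -/
lemma StablePredictor.base_lipschitz (h : M.StablePredictor Θ) (hΘ : Θ.Nonempty) (b : Vec p) :
    ∃ L : ℝ, 0 ≤ L ∧ ∀ x x', ‖M.base b x - M.base b x'‖ ≤ L * ‖x - x'‖ := by
  obtain ⟨θ, hθ⟩ := hΘ
  obtain ⟨L, hL, h1⟩ := h.osa_lipschitz hθ 0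
  obtain ⟨L', hL', h2⟩ := h.osa_lipschitz hθ b
  refine ⟨L + L', by positivity, fun x x' => ?_⟩
  have e : M.base b x - M.base b x' =
      (M.osa θ 0 x - M.osa θ 0 x') - (M.osa θ b x - M.osa θ b x') := by
    rw [M.osa_eq_sub_base θ b, M.osa_eq_sub_base θ b]; abel
  rw [e]
  refine (norm_sub_le _ _).trans ?_
  rw [add_mul]
  exact add_le_add (h1 x x') (h2 x x')

/-- The baseline grows at most linearly in the regressor, uniformly in its parameter. -/
lemma StablePredictor.base_growth (h : M.StablePredictor Θ) (hΘ : Θ.Nonempty) :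
    ∃ C : ℝ, 0 ≤ C ∧ ∀ b x, ‖M.base b x‖ ≤ C * ‖b‖ * (1 + ‖x‖) := by
  have h1 : ∀ l : Fin p, ∃ C : ℝ, 0 ≤ C ∧ ∀ x,
      ‖M.base (EuclideanSpace.single l (1 : ℝ)) x‖ ≤ C * (1 + ‖x‖) := by
    intro l
    obtain ⟨L, hL, h2⟩ := h.base_lipschitz hΘ (EuclideanSpace.single l (1 : ℝ))
    refine ⟨L + ‖M.base (EuclideanSpace.single l (1 : ℝ)) 0‖, by positivity, fun x => ?_⟩
    have h3 := h2 x 0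
    rw [sub_zero] at h3
    have h4 := norm_sub_norm_le (M.base (EuclideanSpace.single l (1 : ℝ)) x)
      (M.base (EuclideanSpace.single l (1 : ℝ)) 0)
    have := norm_nonneg x
    have := mul_nonneg (norm_nonneg (M.base (EuclideanSpace.single l (1 : ℝ)) 0)) (norm_nonneg x)
    nlinarith
  choose C hC hb using h1
  refine ⟨∑ l, C l, Finset.sum_nonneg fun l _ => hC l, fun b x => ?_⟩
  have e : M.base b x = ∑ l, b l • M.base (EuclideanSpace.single l (1 : ℝ)) x := by
    ext i
    simp [base, Matrix.mulVec, dotProduct, mul_comm]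
  rw [e]
  refine (norm_sum_le _ _).trans ?_
  rw [Finset.sum_mul, Finset.sum_mul]
  refine Finset.sum_le_sum fun l _ => ?_
  rw [norm_smul]
  calc ‖b l‖ * ‖M.base (EuclideanSpace.single l (1 : ℝ)) x‖ ≤ ‖b‖ * (C l * (1 + ‖x‖)) :=
        mul_le_mul (PiLp.norm_apply_le b l) (hb l x) (norm_nonneg _) (norm_nonneg _)
    _ = _ := by ring

lemma StablePredictor.osa_growth (h : M.StablePredictor Θ) {θ : Par p q} (hθ : θ ∈ Θ)
    (c : Vec p) :
    ∃ C : ℝ, 0 ≤ C ∧ ∀ x, ‖M.osa θ c x‖ ≤ C * (1 + ‖x‖) := by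
  obtain ⟨L, hL, h1⟩ := h.osa_lipschitz hθ c
  refine ⟨L + ‖M.osa θ c 0‖, by positivity, fun x => ?_⟩
  have h3 := h1 x 0
  rw [sub_zero] at h3
  have h4 := norm_sub_norm_le (M.osa θ c x) (M.osa θ c 0)
  have := norm_nonneg x
  have := mul_nonneg (norm_nonneg (M.osa θ c 0)) (norm_nonneg x)
  nlinarith

/-- Local equicontinuity of the predictor in the parameter, relative to the size of the regressor:
the difference to the predictor at regressor `0` has a derivative of size `O(‖x‖)`. -/
lemma StablePredictor.osa_equicontinuous (h : M.StablePredictor Θ) {θ : Par p q} (hθ : θ ∈ Θ)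
    {ε : ℝ} (hε : 0 < ε) :
    ∃ r : ℝ, 0 < r ∧ ∀ θ', dist θ' θ < r → ∀ x, ‖M.osa θ' 0 x - M.osa θ 0 x‖ ≤ ε * (1 + ‖x‖) := by
  obtain ⟨U, hU, hΘU, h⟩ := h.regressor
  obtain ⟨hd, C, hC, H⟩ := h 0
  obtain ⟨r₀, hr₀, hball⟩ := Metric.isOpen_iff.1 hU θ (hΘU hθ)
  obtain ⟨r₁, hr₁, hcont⟩ := Metric.continuousAt_iff.1 (hd θ (hΘU hθ) 0).continuousAt ε hε
  refine ⟨min r₀ (min r₁ (ε / (C + 1))), by positivity, fun θ' hθ' x => ?_⟩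
  obtain ⟨g0, g1, g2⟩ : dist θ' θ < r₀ ∧ dist θ' θ < r₁ ∧ dist θ' θ < ε / (C + 1) := by
    simpa [lt_min_iff] using hθ'
  have hL := (convex_ball θ r₀).norm_image_sub_le_of_norm_fderiv_le (𝕜 := ℝ)
    (f := fun t => M.osa t 0 x - M.osa t 0 0) (C := C * ‖x‖) (x := θ) (y := θ')
    (fun t ht => (hd t (hball ht) x).sub (hd t (hball ht) 0))
    (fun t ht => by
      have e : fderiv ℝ (fun t => M.osa t 0 x - M.osa t 0 0) t = _ :=
        fderiv_fun_sub (hd t (hball ht) x) (hd t (hball ht) 0)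
      rw [e]
      simpa using ((H t (hball ht)).2 x 0).2)
    (Metric.mem_ball_self hr₀) g0
  have h0 := hcont g1
  rw [dist_eq_norm] at h0
  have e : M.osa θ' 0 x - M.osa θ 0 x = (M.osa θ' 0 x - M.osa θ' 0 0 - (M.osa θ 0 x - M.osa θ 0 0))
      + (M.osa θ' 0 0 - M.osa θ 0 0) := by abel
  rw [e]
  refine (norm_add_le _ _).trans ?_
  rw [dist_eq_norm, lt_div_iff₀ (by positivity)] at g2
  have hx := norm_nonneg x
  have : C * ‖θ' - θ‖ ≤ ε := by nlinarith [norm_nonneg (θ' - θ)]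
  have := mul_le_mul_of_nonneg_right this hx
  nlinarith

lemma StablePredictor.continuousAt_learn (h : M.StablePredictor Θ) {θ : Par p q} (hθ : θ ∈ Θ)
    (x : Reg na nb ny nu) : ContinuousAt (fun θ' : Par p q => M.learn θ'.2 x) θ := by
  obtain ⟨U, hU, hΘU, h⟩ := h.regressor
  have h1 := ((h 0).1 θ (hΘU hθ) x).continuousAt
  have h2 : (fun θ' : Par p q => M.learn θ'.2 x) = fun θ' => M.osa θ' 0 x - M.base θ'.1 x := by
    funext θ'; simp [osa, base]
  rw [h2]
  refine h1.sub ?_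
  have : Continuous fun θ' : Par p q => M.base θ'.1 x := by
    unfold base
    fun_prop
  exact this.continuousAt

end Components

end Regressors

/-! ### A strong law for martingale transforms -/

section StrongLaw

/-- Partial summation: a nonnegative sequence of bounded averages is summable against `1/(i+1)²`. -/
lemma sum_div_sq_le {a : ℕ → ℝ} (ha : ∀ i, 0 ≤ a i) {B : ℝ}
    (h : ∀ N : ℕ, ∑ i ∈ Finset.range N, a i ≤ B * N) (N : ℕ) :
    ∑ i ∈ Finset.range N, a i / ((i : ℝ) + 1) ^ 2 ≤ 3 * B := by
  have hB : 0 ≤ B := by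
    have := h 1
    simp only [Finset.sum_range_one, Nat.cast_one, mul_one] at this
    exact (ha 0).trans this
  -- The bound that propagates by induction, with a telescoping error term.
  have key : ∀ N : ℕ, ∑ i ∈ Finset.range N, a i / ((i : ℝ) + 1) ^ 2 ≤
      (∑ i ∈ Finset.range N, a i) / ((N : ℝ) + 1) ^ 2 + 2 * B * (1 - 1 / ((N : ℝ) + 1)) := by
    intro N
    induction N with
    | zero => simp
    | succ N ih =>
      have hS := h (N + 1)
      have hn : (0 : ℝ) ≤ N := Nat.cast_nonneg N
      have e : (∑ i ∈ Finset.range (N + 1), a i) * (1 / ((N : ℝ) + 1) ^ 2 - 1 / ((N : ℝ) + 1 + 1) ^ 2)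
          ≤ 2 * B * (1 / ((N : ℝ) + 1) - 1 / ((N : ℝ) + 1 + 1)) := by
        have h1 : (0 : ℝ) ≤ 1 / ((N : ℝ) + 1) ^ 2 - 1 / ((N : ℝ) + 1 + 1) ^ 2 := by
          rw [sub_nonneg]
          gcongr
          linarith
        refine (mul_le_mul_of_nonneg_right hS h1).trans ?_
        rw [mul_comm (2 : ℝ) B, mul_assoc B, mul_assoc B]
        refine mul_le_mul_of_nonneg_left ?_ hB
        push_cast
        rw [div_sub_div _ _ (by positivity) (by positivity),
          div_sub_div _ _ (by positivity) (by positivity), mul_div_assoc', mul_div_assoc',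
          div_le_div_iff₀ (by positivity) (by positivity)]
        have hp : 0 < ((N : ℝ) + 1) := by positivity
        have : 0 ≤ ((N : ℝ) + 1) ^ 2 * ((N : ℝ) + 2) := by positivity
        nlinarith
      rw [Finset.sum_range_succ, Finset.sum_range_succ] at *
      push_cast
      have e2 : (∑ i ∈ Finset.range N, a i + a N) * (1 / ((N : ℝ) + 1) ^ 2 - 1 / ((N : ℝ) + 1 + 1) ^ 2)
        = (∑ i ∈ Finset.range N, a i) / ((N : ℝ) + 1) ^ 2 + a N / ((N : ℝ) + 1) ^ 2 -
          (∑ i ∈ Finset.range N, a i + a N) / ((N : ℝ) + 1 + 1) ^ 2 := by ring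
      rw [e2] at e
      linarith
  refine (key N).trans ?_
  have hn : (0 : ℝ) ≤ N := Nat.cast_nonneg N
  have h1 : (∑ i ∈ Finset.range N, a i) / ((N : ℝ) + 1) ^ 2 ≤ B := by
    rw [div_le_iff₀ (by positivity)]
    refine (h N).trans (mul_le_mul_of_nonneg_left (by nlinarith) hB)
  have h2 : 2 * B * (1 - 1 / ((N : ℝ) + 1)) ≤ 2 * B * 1 := by
    refine mul_le_mul_of_nonneg_left ?_ (by positivity)
    have : 0 ≤ 1 / ((N : ℝ) + 1) := by positivity
    linarith
  linarith

/-- Kronecker's lemma for the weights `i + 1`. -/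
lemma tendsto_average_zero_of_tendsto_sum_div {x : ℕ → ℝ} {m : ℝ}
    (h : Tendsto (fun N => ∑ i ∈ Finset.range N, x i / ((i : ℝ) + 1)) atTop (𝓝 m)) :
    Tendsto (fun N : ℕ => (N : ℝ)⁻¹ * ∑ i ∈ Finset.range N, x i) atTop (𝓝 0) := by
  have key : ∀ N : ℕ, ∑ i ∈ Finset.range N, x i =
      N * (∑ i ∈ Finset.range N, x i / ((i : ℝ) + 1)) -
        ∑ j ∈ Finset.range N, ∑ i ∈ Finset.range j, x i / ((i : ℝ) + 1) := by
    intro N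
    induction N with
    | zero => simp
    | succ N ih =>
      rw [Finset.sum_range_succ, ih, Finset.sum_range_succ (fun i => x i / ((i : ℝ) + 1)),
        Finset.sum_range_succ (fun j => ∑ i ∈ Finset.range j, x i / ((i : ℝ) + 1))]
      have : (N : ℝ) + 1 ≠ 0 := by positivity
      push_cast
      field_simp
      ring
  have := h.sub h.cesaro
  rw [sub_self] at this
  refine this.congr' ?_
  filter_upwards [eventually_gt_atTop 0] with N hN
  have : (N : ℝ) ≠ 0 := by positivity
  rw [key]
  field_simp

variable {Ω : Type*} [m0 : MeasurableSpace Ω] {P : Measure Ω} [IsProbabilityMeasure P]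

/-- A martingale transform with square-summable weights converges: it is bounded in `L²`. -/
lemma ae_tendsto_transform_of_bounded (F : Filtration ℕ m0) {ξ h : ℕ → Ω → ℝ}
    (hξ : ∀ n, Measurable[F (n + 1)] (ξ n)) (hh : ∀ n, Measurable[F n] (h n))
    (hind : ∀ n, Indep (F n) (MeasurableSpace.comap (ξ n) inferInstance) P)
    (hL2 : ∀ n, MemLp (ξ n) 2 P) (hmean : ∀ n, ∫ ω, ξ n ω ∂P = 0)
    {σ2 : ℝ} (hvar : ∀ n, ∫ ω, ξ n ω ^ 2 ∂P ≤ σ2) {K : ℝ}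
    (hK : ∀ N ω, ∑ i ∈ Finset.range N, h i ω ^ 2 ≤ K) :
    ∀ᵐ ω ∂P, ∃ m, Tendsto (fun N => ∑ i ∈ Finset.range N, ξ i ω * h i ω) atTop (𝓝 m) := by
  have hξ0 : ∀ n, Measurable (ξ n) := fun n => (hξ n).mono (F.le _) le_rfl
  have hh0 : ∀ n, Measurable (h n) := fun n => (hh n).mono (F.le _) le_rfl
  have hindep : ∀ n (Y : Ω → ℝ), Measurable[F n] Y → IndepFun Y (ξ n) P := fun n Y hY =>
    (IndepFun_iff_Indep _ _ _).2 (indep_of_indep_of_le_left (hind n) hY.comap_le)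
  have hK0 : 0 ≤ K := by
    obtain ⟨ω⟩ : Nonempty Ω := P.nonempty_of_neZero
    simpa using hK 0 ω
  have hbd : ∀ n ω, ‖h n ω‖ ≤ √K := by
    intro n ω
    refine Real.le_sqrt_of_sq_le ?_
    have := hK (n + 1) ω
    rw [Finset.sum_range_succ] at this
    have h2 : 0 ≤ ∑ i ∈ Finset.range n, h i ω ^ 2 := Finset.sum_nonneg fun i _ => sq_nonneg _
    rw [Real.norm_eq_abs, sq_abs]
    linarith
  have hprod : ∀ n, MemLp (fun ω => ξ n ω * h n ω) 2 P := fun n =>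
    (hL2 n).of_le_mul (c := √K) ((hξ0 n).mul (hh0 n)).aestronglyMeasurable
      (Eventually.of_forall fun ω => by
        rw [norm_mul, mul_comm]
        exact mul_le_mul_of_nonneg_right (hbd n ω) (norm_nonneg _))
  set M : ℕ → Ω → ℝ := fun N ω => ∑ i ∈ Finset.range N, ξ i ω * h i ω with hM
  have hMF : ∀ n, Measurable[F n] (M n) := by
    intro n
    refine Finset.measurable_fun_sum _ fun i hi => ?_
    have hi' := Finset.mem_range.1 hi
    exact ((hξ i).mono (F.mono hi') le_rfl).mul ((hh i).mono (F.mono hi'.le) le_rfl)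
  have hM0 : ∀ n, Measurable (M n) := fun n => (hMF n).mono (F.le _) le_rfl
  have hML : ∀ n, MemLp (M n) 2 P := fun n => memLp_finsetSum _ fun i _ => hprod i
  have hsucc : ∀ n, M (n + 1) = fun ω => M n ω + ξ n ω * h n ω := by
    intro n; funext ω; simp only [hM]; rw [Finset.sum_range_succ]
  have hmart : Martingale M F P := by
    refine martingale_of_condExp_sub_eq_zero_nat (fun n => (hMF n).stronglyMeasurable)
      (fun n => (hML n).integrable one_le_two) fun n => ?_
    have e : M (n + 1) - M n = h n * ξ n := by
      rw [hsucc]; funext ω; simp [mul_comm]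
    rw [e]
    have h1 := condExp_mul_of_stronglyMeasurable_left (μ := P) (m := F n) (f := h n) (g := ξ n)
      (hh n).stronglyMeasurable
      (by
        have := (hprod n).integrable one_le_two
        refine this.congr (Eventually.of_forall fun ω => ?_)
        simp [mul_comm]) ((hL2 n).integrable one_le_two)
    have h2 := condExp_indep_eq (μ := P) (hξ0 n).comap_le (F.le n)
      (comap_measurable (ξ n)).stronglyMeasurable (hind n).symm
    filter_upwards [h1, h2] with ω w1 w2
    rw [w1, Pi.mul_apply, w2, hmean n]
    simp
  have hsq : ∀ n, Integrable (fun ω => M n ω ^ 2) P := fun n => (hML n).integrable_sq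
  have hhint : ∀ n, Integrable (fun ω => h n ω ^ 2) P := fun n =>
    Integrable.of_bound ((hh0 n).pow_const 2).aestronglyMeasurable (√K ^ 2)
      (Eventually.of_forall fun ω => by
        rw [norm_pow]; exact pow_le_pow_left₀ (norm_nonneg _) (hbd n ω) 2)
  have hmom : ∀ n, ∫ ω, M n ω ^ 2 ∂P ≤ σ2 * ∫ ω, ∑ i ∈ Finset.range n, h i ω ^ 2 ∂P := by
    intro n
    induction n with
    | zero => simp [hM]
    | succ n ih =>
      have e : (fun ω => M (n + 1) ω ^ 2) = fun ω => M n ω ^ 2 + 2 * (M n ω * (ξ n ω * h n ω))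
          + (ξ n ω * h n ω) ^ 2 := by
        rw [hsucc]; funext ω; ring
      have i1 : Integrable (fun ω => M n ω * (ξ n ω * h n ω)) P := (hML n).integrable_mul (hprod n)
      have e1 : ∫ ω, M n ω * (ξ n ω * h n ω) ∂P = 0 := by
        have := (hindep n (fun ω => M n ω * h n ω) ((hMF n).mul (hh n))).integral_fun_mul_eq_mul_integral
          ((hM0 n).mul (hh0 n)).aestronglyMeasurable (hξ0 n).aestronglyMeasurable
        rw [hmean n, mul_zero] at this
        rw [← this]
        congr 1; funext ω; ring
      have e2 : ∫ ω, (ξ n ω * h n ω) ^ 2 ∂P = (∫ ω, h n ω ^ 2 ∂P) * ∫ ω, ξ n ω ^ 2 ∂P := by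
        have h3 : IndepFun (fun ω => h n ω ^ 2) (fun ω => ξ n ω ^ 2) P :=
          (hindep n (h n) (hh n)).comp (φ := fun t : ℝ => t ^ 2) (ψ := fun t : ℝ => t ^ 2)
            (measurable_id.pow_const 2) (measurable_id.pow_const 2)
        rw [← h3.integral_fun_mul_eq_mul_integral ((hh0 n).pow_const 2).aestronglyMeasurable
          ((hξ0 n).pow_const 2).aestronglyMeasurable]
        congr 1; funext ω; ring
      have e3 : ∫ ω, ∑ i ∈ Finset.range (n + 1), h i ω ^ 2 ∂P
          = ∫ ω, ∑ i ∈ Finset.range n, h i ω ^ 2 ∂P + ∫ ω, h n ω ^ 2 ∂P := by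
        simp_rw [Finset.sum_range_succ]
        exact integral_add (integrable_finsetSum _ fun i _ => hhint i) (hhint n)
      have i2 : Integrable (fun ω => M n ω ^ 2 + 2 * (M n ω * (ξ n ω * h n ω))) P :=
        (hsq n).add (i1.const_mul 2)
      rw [e, integral_add i2 (hprod n).integrable_sq,
        integral_add (hsq n) (i1.const_mul 2), integral_const_mul, e1, e2, e3]
      have h4 : 0 ≤ ∫ ω, h n ω ^ 2 ∂P := integral_nonneg fun ω => sq_nonneg _
      nlinarith [hvar n]
  have hσ : 0 ≤ σ2 := (integral_nonneg fun ω => sq_nonneg (ξ 0 ω)).trans (hvar 0)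
  have hbound : ∀ n, eLpNorm (M n) 1 P ≤ ((1 + σ2 * K).toNNReal : ℝ≥0∞) := by
    intro n
    rw [eLpNorm_one_eq_lintegral_enorm, ← ofReal_integral_norm_eq_lintegral_enorm
      ((hML n).integrable one_le_two)]
    refine ENNReal.ofReal_le_ofReal ?_
    have h5 : ∫ ω, ‖M n ω‖ ∂P ≤ ∫ ω, (1 + M n ω ^ 2) ∂P :=
      integral_mono ((hML n).integrable one_le_two).norm ((integrable_const _).add (hsq n))
        fun ω => by
          have : ‖M n ω‖ ^ 2 = M n ω ^ 2 := by rw [Real.norm_eq_abs, sq_abs]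
          simp only
          nlinarith [sq_nonneg (‖M n ω‖ - 1)]
    rw [integral_add (integrable_const _) (hsq n)] at h5
    have h6 : ∫ ω, ∑ i ∈ Finset.range n, h i ω ^ 2 ∂P ≤ K := by
      have := integral_mono (μ := P) (integrable_finsetSum (Finset.range n) fun i _ => hhint i)
        (integrable_const K) (fun ω => hK n ω)
      simpa using this
    have h7 := mul_le_mul_of_nonneg_left h6 hσ
    simp only [integral_const, probReal_univ, smul_eq_mul, mul_one] at h5
    linarith [hmom n]
  exact hmart.submartingale.exists_ae_tendsto_of_bdd hbound

/-- A strong law for martingale transforms whose weights have almost surely finite average power.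
No moments of the weights are assumed: they are switched off when their weighted energy
exceeds a level, which changes nothing on the event that the energy stays below the level. -/
theorem ae_tendsto_average_transform (F : Filtration ℕ m0) {ξ g : ℕ → Ω → ℝ}
    (hξ : ∀ n, Measurable[F (n + 1)] (ξ n)) (hg : ∀ n, Measurable[F n] (g n))
    (hind : ∀ n, Indep (F n) (MeasurableSpace.comap (ξ n) inferInstance) P)
    (hL2 : ∀ n, MemLp (ξ n) 2 P) (hmean : ∀ n, ∫ ω, ξ n ω ∂P = 0)
    {σ2 : ℝ} (hvar : ∀ n, ∫ ω, ξ n ω ^ 2 ∂P ≤ σ2)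
    (hpow : ∀ᵐ ω ∂P, ∃ B : ℝ, ∀ N : ℕ, ∑ i ∈ Finset.range N, g i ω ^ 2 ≤ B * N) :
    ∀ᵐ ω ∂P, Tendsto (fun N : ℕ => (N : ℝ)⁻¹ * ∑ i ∈ Finset.range N, ξ i ω * g i ω) atTop (𝓝 0) := by
  classical
  set A : ℕ → Ω → ℝ := fun n ω => ∑ i ∈ Finset.range n, (g i ω / ((i : ℝ) + 1)) ^ 2 with hA
  have hAmono : ∀ ω, Monotone fun n => A n ω := fun ω => monotone_nat_of_le_succ fun n => by
    simp only [hA]; rw [Finset.sum_range_succ]; nlinarith [sq_nonneg (g n ω / ((n : ℝ) + 1))]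
  have hAF : ∀ n, Measurable[F n] (A (n + 1)) := by
    intro n
    refine Finset.measurable_fun_sum _ fun i hi => ?_
    have hi' := Nat.lt_succ_iff.1 (Finset.mem_range.1 hi)
    exact (((hg i).mono (F.mono hi') le_rfl).div_const _).pow_const 2
  let h : ℕ → ℕ → Ω → ℝ := fun K n ω => if A (n + 1) ω ≤ K then g n ω / ((n : ℝ) + 1) else 0
  have hconv : ∀ K : ℕ, ∀ᵐ ω ∂P, ∃ m,
      Tendsto (fun N => ∑ i ∈ Finset.range N, ξ i ω * h K i ω) atTop (𝓝 m) := by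
    intro K
    refine ae_tendsto_transform_of_bounded F hξ (fun n => ?_) hind hL2 hmean hvar (K := K) ?_
    · exact Measurable.ite (measurableSet_le (hAF n) measurable_const) ((hg n).div_const _)
        measurable_const
    · intro N ω
      induction N with
      | zero => simp
      | succ N ih =>
        by_cases hN : A (N + 1) ω ≤ K
        · refine le_trans (Finset.sum_le_sum fun i hi => ?_) hN
          simp only [h]
          split_ifs
          · exact le_rfl
          · rw [zero_pow two_ne_zero]; exact sq_nonneg _
        · rw [Finset.sum_range_succ]
          simp only [h, if_neg hN] at ih ⊢
          simpa using ih
  filter_upwards [ae_all_iff.2 hconv, hpow] with ω h1 ⟨B, h2⟩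
  obtain ⟨K, hK⟩ := exists_nat_ge (3 * B)
  obtain ⟨m, hm⟩ := h1 K
  have hle : ∀ n, A (n + 1) ω ≤ K := fun n => by
    have := sum_div_sq_le (fun i => sq_nonneg (g i ω)) h2 (n + 1)
    simp only [hA, div_pow]
    exact this.trans hK
  refine tendsto_average_zero_of_tendsto_sum_div (m := m) (hm.congr fun N => ?_)
  refine Finset.sum_congr rfl fun i _ => ?_
  simp only [h, if_pos (hle i)]
  ring

/-- If `Z` is independent of `(A, B)` and `A` is independent of `B`, then `(Z, A)` is independent
of `B`. -/
lemma indepFun_prodMk_left {α β γ : Type*} [MeasurableSpace α] [MeasurableSpace β]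
    [MeasurableSpace γ] {Z : Ω → α} {A : Ω → β} {B : Ω → γ} (hZ : Measurable Z) (hA : Measurable A)
    (hB : Measurable B) (h1 : IndepFun Z (fun ω => (A ω, B ω)) P) (h2 : IndepFun A B P) :
    IndepFun (fun ω => (Z ω, A ω)) B P := by
  have h3 : IndepFun Z A P := h1.comp (φ := id) (ψ := Prod.fst) measurable_id measurable_fst
  rw [indepFun_iff_map_prod_eq_prod_map_map (by fun_prop) (by fun_prop)] at h1 h2 h3 ⊢
  have : IsProbabilityMeasure (P.map Z) := Measure.isProbabilityMeasure_map hZ.aemeasurable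
  have : IsProbabilityMeasure (P.map A) := Measure.isProbabilityMeasure_map hA.aemeasurable
  have : IsProbabilityMeasure (P.map B) := Measure.isProbabilityMeasure_map hB.aemeasurable
  rw [h3]
  apply MeasurableEquiv.prodAssoc.map_measurableEquiv_injective
  rw [Measure.prodAssoc_prod, ← h2, ← h1, Measure.map_map (MeasurableEquiv.measurable _) (by fun_prop)]
  rfl

end StrongLaw

/-! ### Average power of the regressors -/

section Trajectories

variable {na nb ny nu : ℕ}

lemma continuous_nextReg : Continuous fun t : Reg na nb ny nu × Vec ny × Vec nu =>
    nextReg t.1 t.2.1 t.2.2 := by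
  unfold nextReg
  refine (PiLp.continuous_toLp 2 _).comp (continuous_pi fun s => ?_)
  rcases s with s | s <;> simp only [Sum.elim_inl, Sum.elim_inr] <;> split_ifs <;> fun_prop

lemma outBlock_of_recursion {z : ℕ → Reg na nb ny nu} {y : ℕ → Vec ny} {v : ℕ → Vec nu}
    (hz : ∀ n, z (n + 1) = nextReg (z n) (y n) (v n)) (m : ℕ) (s : Fin na) (hs : s.val < m) :
    outBlock (z m) s = y (m - 1 - s.val) := by
  induction m generalizing s with
  | zero => omega
  | succ m ih =>
    rw [hz, outBlock_nextReg]
    split_ifs with h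
    · simp [h]
    · rw [ih _ (by simp only; omega)]
      congr 1; simp only; omega

lemma inBlock_of_recursion {z : ℕ → Reg na nb ny nu} {y : ℕ → Vec ny} {v : ℕ → Vec nu}
    (hz : ∀ n, z (n + 1) = nextReg (z n) (y n) (v n)) (m : ℕ) (s : Fin (nb + 1)) (hs : s.val < m) :
    inBlock (z m) s = v (m - 1 - s.val) := by
  induction m generalizing s with
  | zero => omega
  | succ m ih =>
    rw [hz, inBlock_nextReg]
    split_ifs with h
    · simp [h]
    · rw [ih _ (by simp only; omega)]
      congr 1; simp only; omega

/-- The regressor after `m` steps from `x` of the system without input and noise. -/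
def freeReg (f : Reg na nb ny nu → Vec ny) (x : Reg na nb ny nu) (m : ℕ) : Reg na nb ny nu :=
  simReg f (fun _ => 0) (fun _ => 0) 0 x m

lemma freeReg_succ (f : Reg na nb ny nu → Vec ny) (x : Reg na nb ny nu) (m : ℕ) :
    freeReg f x (m + 1) = nextReg (freeReg f x m) (f (freeReg f x m)) 0 := by
  simp [freeReg, simReg]

variable {f : Reg na nb ny nu → Vec ny} {L : ℝ}

/-- A driven trajectory stays within a multiple of the size of the input and the noise of the free
trajectory from the same regressor. -/
lemma norm_sub_freeReg_le (hL : 0 ≤ L) (hf : ∀ x x', ‖f x - f x'‖ ≤ L * ‖x - x'‖)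
    {z : ℕ → Reg na nb ny nu} {e : ℕ → Vec ny} {v : ℕ → Vec nu}
    (hz : ∀ n, z (n + 1) = nextReg (z n) (f (z n) + e n) (v n)) (m : ℕ) :
    ‖z m - freeReg f (z 0) m‖ ≤
      ((na + nb + 1) * (1 + L)) ^ m * ∑ j ∈ Finset.range m, (‖e j‖ + ‖v j‖) := by
  have hD : (1 : ℝ) ≤ na + nb + 1 := by
    have : (0 : ℝ) ≤ na + nb := by positivity
    linarith
  set D : ℝ := na + nb + 1 with hDdef
  have hG : 1 ≤ D * (1 + L) := by nlinarith
  induction m with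
  | zero => simp [freeReg, simReg]
  | succ m ih =>
    rw [hz, freeReg_succ, Finset.sum_range_succ]
    refine (norm_nextReg_sub_le _ _ _ _ _ _).trans ?_
    set d := ‖z m - freeReg f (z 0) m‖ with hd
    have h1 : ‖f (z m) + e m - f (freeReg f (z 0) m)‖ ≤ L * d + ‖e m‖ := by
      have : f (z m) + e m - f (freeReg f (z 0) m) = (f (z m) - f (freeReg f (z 0) m)) + e m := by
        abel
      rw [this]
      exact (norm_add_le _ _).trans (by linarith [hf (z m) (freeReg f (z 0) m)])
    rw [sub_zero]
    have h2 : D ≤ (D * (1 + L)) ^ (m + 1) := by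
      refine le_trans ?_ (le_self_pow₀ hG (Nat.succ_ne_zero m))
      nlinarith
    have hw : 0 ≤ ‖e m‖ + ‖v m‖ := by positivity
    have h3 := mul_le_mul_of_nonneg_right h2 hw
    have h4 := mul_le_mul_of_nonneg_left ih (zero_le_one.trans hG)
    calc D * (d + ‖f (z m) + e m - f (freeReg f (z 0) m)‖ + ‖v m‖)
        ≤ D * (d + (L * d + ‖e m‖) + ‖v m‖) := by
          refine mul_le_mul_of_nonneg_left ?_ (by linarith)
          linarith
      _ = D * (1 + L) * d + D * (‖e m‖ + ‖v m‖) := by ring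
      _ ≤ _ := by rw [pow_succ'] at h3 ⊢; rw [mul_add (D * (1 + L) * _)]; linarith

/-- Squared form of a contraction over `m` steps with forcing `w`: bounded average power of the
forcing gives bounded average power. -/
lemma average_power_of_contraction {r w : ℕ → ℝ} {m : ℕ} {K G B : ℝ} (hr : ∀ k, 0 ≤ r k)
    (hrec : ∀ k, r (k + m) ≤ r k / 2 + K + G * ∑ j ∈ Finset.range m, w (k + j))
    (hw : ∀ N : ℕ, ∑ k ∈ Finset.range N, w k ^ 2 ≤ B * (N + 1)) :
    ∃ B' : ℝ, ∀ N : ℕ, ∑ k ∈ Finset.range N, r k ^ 2 ≤ B' * N := by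
  have hB : 0 ≤ B := by simpa using hw 0
  have hstep : ∀ k, r (k + m) ^ 2 ≤ r k ^ 2 / 2 +
      (4 * K ^ 2 + 4 * G ^ 2 * (m * ∑ j ∈ Finset.range m, w (k + j) ^ 2)) := by
    intro k
    have h1 := pow_le_pow_left₀ (hr _) (hrec k) 2
    have h2 := sq_sum_le_card_mul_sum_sq (s := Finset.range m) (f := fun j => w (k + j))
    rw [Finset.card_range] at h2
    have h3 := mul_le_mul_of_nonneg_left h2 (sq_nonneg G)
    set S := ∑ j ∈ Finset.range m, w (k + j)
    nlinarith [sq_nonneg (r k / 2 - (K + G * S)), sq_nonneg (K - G * S)]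
  set R := ∑ k ∈ Finset.range m, r k ^ 2 with hR
  have hR0 : 0 ≤ R := Finset.sum_nonneg fun _ _ => sq_nonneg _
  have hsum : ∀ N : ℕ, ∑ k ∈ Finset.range N, r k ^ 2 ≤
      2 * R + 8 * K ^ 2 * N + 8 * G ^ 2 * m * (m * (B * (N + m + 1))) := by
    intro N
    have h1 : ∑ k ∈ Finset.range N, r k ^ 2 ≤ R + ∑ k ∈ Finset.range N, r (k + m) ^ 2 := by
      have e : ∑ k ∈ Finset.range (m + N), r k ^ 2 = R + ∑ k ∈ Finset.range N, r (k + m) ^ 2 := by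
        rw [Finset.sum_range_add]
        simp_rw [add_comm m]
        rfl
      rw [← e]
      exact Finset.sum_le_sum_of_subset_of_nonneg (Finset.range_mono (by omega))
        fun _ _ _ => sq_nonneg _
    have h2 : ∑ k ∈ Finset.range N, r (k + m) ^ 2 ≤ (∑ k ∈ Finset.range N, r k ^ 2) / 2 +
        (4 * K ^ 2 * N + 4 * G ^ 2 * m *
          ∑ k ∈ Finset.range N, ∑ j ∈ Finset.range m, w (k + j) ^ 2) := by
      refine (Finset.sum_le_sum fun k _ => hstep k).trans (le_of_eq ?_)
      rw [Finset.sum_add_distrib, Finset.sum_add_distrib, Finset.sum_div, ← Finset.mul_sum,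
        ← Finset.mul_sum, ← Finset.mul_sum, Finset.sum_const, Finset.card_range, nsmul_eq_mul]
      ring
    have h3 : ∑ k ∈ Finset.range N, ∑ j ∈ Finset.range m, w (k + j) ^ 2 ≤
        m * (B * (N + m + 1)) := by
      rw [Finset.sum_comm]
      have : ∀ j ∈ Finset.range m, ∑ k ∈ Finset.range N, w (k + j) ^ 2 ≤ B * (N + m + 1) := by
        intro j hj
        have hj' := Finset.mem_range.1 hj
        have h4 := hw (j + N)
        rw [Finset.sum_range_add] at h4
        simp_rw [add_comm j] at h4
        have h5 : 0 ≤ ∑ k ∈ Finset.range j, w k ^ 2 := Finset.sum_nonneg fun _ _ => sq_nonneg _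
        have h6 : B * (((N + j : ℕ) : ℝ) + 1) ≤ B * (N + m + 1) := by
          refine mul_le_mul_of_nonneg_left ?_ hB
          push_cast
          have : (j : ℝ) ≤ m := by exact_mod_cast hj'.le
          linarith
        linarith
      refine (Finset.sum_le_sum this).trans (le_of_eq ?_)
      simp
    have h7 : 4 * G ^ 2 * m * (∑ k ∈ Finset.range N, ∑ j ∈ Finset.range m, w (k + j) ^ 2) ≤
        4 * G ^ 2 * m * (m * (B * (N + m + 1))) := mul_le_mul_of_nonneg_left h3 (by positivity)
    linarith
  refine ⟨2 * R + 8 * K ^ 2 + 8 * G ^ 2 * m * (m * (B * (m + 2))), fun N => ?_⟩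
  rcases Nat.eq_zero_or_pos N with rfl | hN
  · simp
  have hN1 : (1 : ℝ) ≤ N := by exact_mod_cast hN
  refine (hsum N).trans ?_
  have h1 : 8 * G ^ 2 * m * (m * (B * (N + m + 1))) ≤ 8 * G ^ 2 * m * (m * (B * ((m + 2) * N))) := by
    have hm : (0 : ℝ) ≤ m := Nat.cast_nonneg m
    gcongr
    nlinarith
  nlinarith

end Trajectories

section Stability

variable {Ω : Type*} [MeasurableSpace Ω] {P : Measure Ω} [IsProbabilityMeasure P]
  {na nb ny nu : ℕ} {f : Reg na nb ny nu → Vec ny} {u : ℤ → Ω → Vec nu} {e : ℕ → Ω → Vec ny}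
  {L : ℝ}

lemma measurable_simReg (hf : Measurable f) (hu : ∀ k, Measurable (u k)) (he : ∀ k, Measurable (e k))
    (x : Reg na nb ny nu) (m : ℕ) :
    Measurable fun ω => simReg f (fun i => u i ω) (fun i => e i ω) 0 x m := by
  induction m with
  | zero => exact measurable_const
  | succ m ih =>
    exact continuous_nextReg.measurable.comp
      (ih.prodMk (((hf.comp ih).add (he _)).prodMk (hu _)))

lemma measurable_simOut (hf : Measurable f) (hu : ∀ k, Measurable (u k)) (he : ∀ k, Measurable (e k))
    (x : Reg na nb ny nu) (m : ℕ) :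
    Measurable fun ω => simOut f (fun i => u i ω) (fun i => e i ω) 0 x m :=
  (hf.comp (measurable_simReg hf hu he x m)).add (he _)

lemma measurable_enorm_simOut_sub (hf : Measurable f) (hu : ∀ k, Measurable (u k))
    (he : ∀ k, Measurable (e k)) (x x' : Reg na nb ny nu) (m : ℕ) :
    Measurable fun ω => ‖simOut f (fun i => u i ω) (fun i => e i ω) 0 x m
      - simOut f (fun i => u i ω) (fun i => e i ω) 0 x' m‖ₑ :=
  ((measurable_simOut hf hu he x m).sub (measurable_simOut hf hu he x' m)).enorm

/-- In the mean, outputs of trajectories from distant regressors become close relative to the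
distance, by passing through regressors at unit distances. -/
lemma StableSystem.lintegral_simOut_sub_le (hsys : StableSystem P f u e) (hf : Measurable f)
    (hu : ∀ k, Measurable (u k)) (he : ∀ k, Measurable (e k)) {η : ℝ} (hη : 0 < η) :
    ∃ m₀, ∀ m ≥ m₀, ∀ (n : ℕ) (x : Reg na nb ny nu), ‖x‖ ≤ n →
      ∫⁻ ω, ‖simOut f (fun i => u i ω) (fun i => e i ω) 0 x m
          - simOut f (fun i => u i ω) (fun i => e i ω) 0 0 m‖ₑ ∂P ≤ n * ENNReal.ofReal η := by
  obtain ⟨C, lam, hC, h0, h1, H⟩ := hsys 2 two_pos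
  have hlim : Tendsto (fun m : ℕ => 8 / η ^ 3 * (C * lam ^ m)) atTop (𝓝 0) := by
    simpa using ((tendsto_pow_atTop_nhds_zero_of_lt_one h0 h1).const_mul C).const_mul (8 / η ^ 3)
  obtain ⟨m₀, hm₀⟩ := eventually_atTop.1 (hlim.eventually_lt_const (half_pos hη))
  refine ⟨m₀, fun m hm n => ?_⟩
  have hstep : ∀ x x' : Reg na nb ny nu, ‖x - x'‖ < 2 →
      ∫⁻ ω, ‖simOut f (fun i => u i ω) (fun i => e i ω) 0 x m
          - simOut f (fun i => u i ω) (fun i => e i ω) 0 x' m‖ₑ ∂P ≤ ENNReal.ofReal η := by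
    intro x x' hx
    -- Pointwise, `a ≤ η / 2 + 8 a⁴ / η³`.
    calc _ ≤ ∫⁻ ω, (ENNReal.ofReal (η / 2) + ENNReal.ofReal (8 / η ^ 3) *
            ‖simOut f (fun i => u i ω) (fun i => e i ω) 0 x m
              - simOut f (fun i => u i ω) (fun i => e i ω) 0 x' m‖ₑ ^ 4) ∂P := by
          refine lintegral_mono fun ω => ?_
          simp only
          rw [← ofReal_norm, ← ENNReal.ofReal_pow (norm_nonneg _),
            ← ENNReal.ofReal_mul (by positivity), ← ENNReal.ofReal_add (by positivity) (by positivity)]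
          refine ENNReal.ofReal_le_ofReal ?_
          set a := ‖simOut f (fun i => u i ω) (fun i => e i ω) 0 x m
              - simOut f (fun i => u i ω) (fun i => e i ω) 0 x' m‖
          have ha : 0 ≤ a := norm_nonneg _
          have hp : 0 ≤ 8 / η ^ 3 * a ^ 4 := by positivity
          rcases le_total a (η / 2) with h | h
          · linarith
          · have h3 : (η / 2) ^ 3 ≤ a ^ 3 := pow_le_pow_left₀ (by positivity) h 3
            have : a ≤ 8 / η ^ 3 * a ^ 4 := by
              rw [div_mul_eq_mul_div, le_div_iff₀ (by positivity)]
              nlinarith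
            linarith
      _ = ENNReal.ofReal (η / 2) + ENNReal.ofReal (8 / η ^ 3) *
            ∫⁻ ω, ‖simOut f (fun i => u i ω) (fun i => e i ω) 0 x m
              - simOut f (fun i => u i ω) (fun i => e i ω) 0 x' m‖ₑ ^ 4 ∂P := by
          rw [lintegral_add_left measurable_const, lintegral_const, measure_univ, mul_one,
            lintegral_const_mul' _ _ ENNReal.ofReal_ne_top]
      _ ≤ ENNReal.ofReal (η / 2) + ENNReal.ofReal (8 / η ^ 3) * ENNReal.ofReal (C * lam ^ m) := by
          gcongr
          exact (H 0 x x' hx m).le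
      _ = ENNReal.ofReal (η / 2 + 8 / η ^ 3 * (C * lam ^ m)) := by
          rw [← ENNReal.ofReal_mul (by positivity), ← ENNReal.ofReal_add (by positivity) (by positivity)]
      _ ≤ ENNReal.ofReal η := ENNReal.ofReal_le_ofReal (by linarith [hm₀ m hm])
  induction n with
  | zero =>
    intro x hx
    have : x = 0 := by simpa using hx
    simp [this]
  | succ n ih =>
    intro x hx
    have hn : (0 : ℝ) < (n : ℝ) + 1 := by positivity
    push_cast at hx
    have hx' : ‖((n : ℝ) / (n + 1)) • x‖ ≤ n := by
      rw [norm_smul, Real.norm_of_nonneg (by positivity), div_mul_eq_mul_div, div_le_iff₀ hn]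
      exact mul_le_mul_of_nonneg_left hx (by positivity)
    have hd : ‖x - ((n : ℝ) / (n + 1)) • x‖ < 2 := by
      have : x - ((n : ℝ) / (n + 1)) • x = (1 / ((n : ℝ) + 1)) • x := by
        nth_rewrite 1 [← one_smul ℝ x]
        rw [← sub_smul]
        congr 1
        field_simp
        ring
      rw [this, norm_smul, Real.norm_of_nonneg (by positivity), div_mul_eq_mul_div, one_mul,
        div_lt_iff₀ hn]
      linarith
    calc _ ≤ ∫⁻ ω, (‖simOut f (fun i => u i ω) (fun i => e i ω) 0 x m
              - simOut f (fun i => u i ω) (fun i => e i ω) 0 (((n : ℝ) / (n + 1)) • x) m‖ₑ +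
            ‖simOut f (fun i => u i ω) (fun i => e i ω) 0 (((n : ℝ) / (n + 1)) • x) m
              - simOut f (fun i => u i ω) (fun i => e i ω) 0 0 m‖ₑ) ∂P := by
          refine lintegral_mono fun ω => ?_
          simp only
          rw [← sub_add_sub_cancel _ (simOut f (fun i => u i ω) (fun i => e i ω) 0
            (((n : ℝ) / (n + 1)) • x) m)]
          exact enorm_add_le _ _
      _ ≤ ENNReal.ofReal η + n * ENNReal.ofReal η := by
          rw [lintegral_add_left (measurable_enorm_simOut_sub hf hu he _ _ m)]
          exact add_le_add (hstep _ _ hd) (ih _ hx')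
      _ = _ := by push_cast; ring

/-- The output of the free system grows at most with a small slope in the initial regressor: the
stability in the mean transfers to it because, by the Lipschitz continuity of `f`, input and noise
move the trajectories by an integrable amount that does not depend on the initial regressor. -/
lemma StableSystem.freeReg_output_le (hsys : StableSystem P f u e) (hL : 0 ≤ L)
    (hf : ∀ x x', ‖f x - f x'‖ ≤ L * ‖x - x'‖)
    (hfm : Measurable f) (hu : ∀ k, Measurable (u k)) (he : ∀ k, Measurable (e k))
    (hui : ∀ k, Integrable (u k) P) (hei : ∀ k, Integrable (e k) P) {η : ℝ} (hη : 0 < η) :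
    ∃ m₀, ∀ m ≥ m₀, ∃ K : ℝ, 0 ≤ K ∧ ∀ x : Reg na nb ny nu, ‖f (freeReg f x m)‖ ≤ η * ‖x‖ + K := by
  obtain ⟨m₀, hm₀⟩ := hsys.lintegral_simOut_sub_le hfm hu he hη
  refine ⟨m₀, fun m hm => ?_⟩
  set R : Ω → ℝ := fun ω => 2 * (L * (((na + nb + 1) * (1 + L)) ^ m *
    ∑ j ∈ Finset.range m, (‖e j ω‖ + ‖u ((j + 1 : ℕ) : ℤ) ω‖))) with hR
  have hRi : Integrable R P :=
    (((integrable_finsetSum _ fun j _ => (hei j).norm.add (hui _).norm).const_mul _).const_mul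
      L).const_mul 2
  have hR0 : ∀ ω, 0 ≤ R ω := fun ω => by
    have : 0 ≤ ∑ j ∈ Finset.range m, (‖e j ω‖ + ‖u ((j + 1 : ℕ) : ℤ) ω‖) :=
      Finset.sum_nonneg fun _ _ => by positivity
    simp only [hR]
    positivity
  have hRint : 0 ≤ ∫ ω, R ω ∂P := integral_nonneg hR0
  refine ⟨η + ∫ ω, R ω ∂P + ‖f (freeReg f 0 m)‖, by positivity, fun x => ?_⟩
  have hdev : ∀ ω (x : Reg na nb ny nu),
      ‖f (simReg f (fun i => u i ω) (fun i => e i ω) 0 x m) - f (freeReg f x m)‖ ≤ R ω / 2 := by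
    intro ω x
    refine (hf _ _).trans ?_
    have := norm_sub_freeReg_le hL hf
      (z := fun m => simReg f (fun i => u i ω) (fun i => e i ω) 0 x m)
      (e := fun j => e j ω) (v := fun j => u ((j + 1 : ℕ) : ℤ) ω)
      (fun n => by simp [simReg]) m
    simp only [hR]
    rw [mul_div_cancel_left₀ _ (two_ne_zero)]
    exact mul_le_mul_of_nonneg_left this hL
  have hpt : ∀ ω, ‖f (freeReg f x m) - f (freeReg f 0 m)‖ₑ ≤
      ‖simOut f (fun i => u i ω) (fun i => e i ω) 0 x m
          - simOut f (fun i => u i ω) (fun i => e i ω) 0 0 m‖ₑ + ENNReal.ofReal (R ω) := by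
    intro ω
    rw [← ofReal_norm, ← ofReal_norm,
      ← ENNReal.ofReal_add (norm_nonneg _) (hR0 ω)]
    refine ENNReal.ofReal_le_ofReal ?_
    have h1 := hdev ω x
    have h2 := hdev ω 0
    set a := f (simReg f (fun i => u i ω) (fun i => e i ω) 0 x m) with ha
    set b := f (simReg f (fun i => u i ω) (fun i => e i ω) 0 0 m) with hb
    have e1 : simOut f (fun i => u i ω) (fun i => e i ω) 0 x m
          - simOut f (fun i => u i ω) (fun i => e i ω) 0 0 m = a - b := by
      simp [simOut, ha, hb]
    have e2 : f (freeReg f x m) - f (freeReg f 0 m) =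
        (a - b) - (a - f (freeReg f x m)) + (b - f (freeReg f 0 m)) := by abel
    rw [e1, e2]
    have h3 := norm_add_le ((a - b) - (a - f (freeReg f x m))) (b - f (freeReg f 0 m))
    have h4 := norm_sub_le (a - b) (a - f (freeReg f x m))
    linarith
  have hn := Nat.ceil_lt_add_one (norm_nonneg x)
  have hmain : ‖f (freeReg f x m) - f (freeReg f 0 m)‖ ≤ ⌈‖x‖⌉₊ * η + ∫ ω, R ω ∂P := by
    rw [← ENNReal.ofReal_le_ofReal_iff (by positivity), ofReal_norm,
      ENNReal.ofReal_add (by positivity) hRint, ofReal_integral_eq_lintegral_ofReal hRi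
        (Eventually.of_forall hR0), ENNReal.ofReal_mul (by positivity), ENNReal.ofReal_natCast]
    calc _ = ∫⁻ _, ‖f (freeReg f x m) - f (freeReg f 0 m)‖ₑ ∂P := by
          rw [lintegral_const, measure_univ, mul_one]
      _ ≤ _ := lintegral_mono hpt
      _ ≤ _ := by
        rw [lintegral_add_left (measurable_enorm_simOut_sub hfm hu he _ _ m)]
        gcongr
        exact hm₀ m hm _ x (Nat.le_ceil _)
  have h5 := norm_sub_norm_le (f (freeReg f x m)) (f (freeReg f 0 m))
  nlinarith

/-- The free system contracts large regressors over some number of steps. -/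
lemma StableSystem.exists_freeReg_contraction (hsys : StableSystem P f u e) (hL : 0 ≤ L)
    (hf : ∀ x x', ‖f x - f x'‖ ≤ L * ‖x - x'‖)
    (hfm : Measurable f) (hu : ∀ k, Measurable (u k)) (he : ∀ k, Measurable (e k))
    (hui : ∀ k, Integrable (u k) P) (hei : ∀ k, Integrable (e k) P) :
    ∃ (m : ℕ) (K : ℝ), ∀ x : Reg na nb ny nu, ‖freeReg f x m‖ ≤ ‖x‖ / 2 + K := by
  have hη : (0 : ℝ) < 1 / (2 * (na + 1)) := by positivity
  obtain ⟨m₀, h⟩ := hsys.freeReg_output_le hL hf hfm hu he hui hei hη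
  choose! K hK0 hK using h
  -- after `m` steps all entries of the regressor are outputs later than `m₀`, or vanishing inputs
  set m := m₀ + na + nb + 1 with hm
  refine ⟨m, ∑ s : Fin na, K (m - 1 - s.val), fun x => ?_⟩
  have hrec := freeReg_succ f x
  refine (norm_le_sum_blocks _).trans ?_
  have h1 : ∀ t : Fin (nb + 1), inBlock (freeReg f x m) t = 0 := fun t =>
    inBlock_of_recursion (y := fun j => f (freeReg f x j)) (v := fun _ => 0) hrec m t (by omega)
  have h2 : ∀ s : Fin na, ‖outBlock (freeReg f x m) s‖ ≤
      1 / (2 * (na + 1)) * ‖x‖ + K (m - 1 - s.val) := fun s => by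
    rw [outBlock_of_recursion (y := fun j => f (freeReg f x j)) (v := fun _ => 0) hrec m s (by omega)]
    exact hK _ (by omega) x
  simp only [h1, norm_zero, Finset.sum_const_zero, add_zero]
  refine (Finset.sum_le_sum fun s _ => h2 s).trans ?_
  rw [Finset.sum_add_distrib]
  simp only [Finset.sum_const, Finset.card_univ, Fintype.card_fin, nsmul_eq_mul]
  refine add_le_add ?_ le_rfl
  rw [← mul_assoc, div_eq_inv_mul ‖x‖]
  refine mul_le_mul_of_nonneg_right ?_ (norm_nonneg x)
  rw [mul_one_div, div_le_iff₀ (by positivity)]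
  linarith

/-- Every trajectory with input and noise of finite average power has finite average power,
whatever its initial regressor and its dependence on the input. -/
theorem StableSystem.average_power (hsys : StableSystem P f u e) (hL : 0 ≤ L)
    (hf : ∀ x x', ‖f x - f x'‖ ≤ L * ‖x - x'‖)
    (hfm : Measurable f) (hu : ∀ k, Measurable (u k)) (he : ∀ k, Measurable (e k))
    (hui : ∀ k, Integrable (u k) P) (hei : ∀ k, Integrable (e k) P)
    {x : ℕ → Reg na nb ny nu} {v : ℕ → Vec nu} {w : ℕ → Vec ny}
    (hx : ∀ k, x (k + 1) = nextReg (x k) (f (x k) + w k) (v (k + 1)))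
    (hv : ∃ B : ℝ, ∀ N : ℕ, ∑ k ∈ Finset.range N, ‖v k‖ ^ 2 ≤ B * N)
    (hw : ∃ B : ℝ, ∀ N : ℕ, ∑ k ∈ Finset.range N, ‖w k‖ ^ 2 ≤ B * N) :
    ∃ B : ℝ, ∀ N : ℕ, ∑ k ∈ Finset.range N, ‖x k‖ ^ 2 ≤ B * N := by
  obtain ⟨m, K, hK⟩ := hsys.exists_freeReg_contraction hL hf hfm hu he hui hei
  obtain ⟨Bv, hv⟩ := hv
  obtain ⟨Bw, hw⟩ := hw
  refine average_power_of_contraction (m := m) (K := K) (G := ((na + nb + 1) * (1 + L)) ^ m)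
    (w := fun k => ‖w k‖ + ‖v (k + 1)‖) (B := 2 * |Bw| + 2 * |Bv|) (fun k => norm_nonneg _)
    (fun k => ?_) fun N => ?_
  · have h1 := norm_sub_freeReg_le hL hf (z := fun j => x (k + j)) (e := fun j => w (k + j))
      (v := fun j => v (k + j + 1)) (fun n => hx (k + n)) m
    have h2 := norm_sub_norm_le (x (k + m)) (freeReg f (x k) m)
    simp only [add_zero] at h1
    linarith [hK (x k)]
  · have h1 : ∑ k ∈ Finset.range N, (‖w k‖ + ‖v (k + 1)‖) ^ 2 ≤
        2 * ∑ k ∈ Finset.range N, ‖w k‖ ^ 2 + 2 * ∑ k ∈ Finset.range N, ‖v (k + 1)‖ ^ 2 := by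
      rw [Finset.mul_sum, Finset.mul_sum, ← Finset.sum_add_distrib]
      refine Finset.sum_le_sum fun k _ => ?_
      nlinarith [sq_nonneg (‖w k‖ - ‖v (k + 1)‖)]
    have h2 : ∑ k ∈ Finset.range N, ‖v (k + 1)‖ ^ 2 ≤ Bv * ((N : ℝ) + 1) := by
      have := hv (N + 1)
      rw [Finset.sum_range_succ'] at this
      push_cast at this
      nlinarith [sq_nonneg ‖v 0‖]
    have hN : (0 : ℝ) ≤ N := Nat.cast_nonneg N
    have h3 : Bv * ((N : ℝ) + 1) ≤ |Bv| * (N + 1) :=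
      mul_le_mul_of_nonneg_right (le_abs_self _) (by positivity)
    have h4 : Bw * (N : ℝ) ≤ |Bw| * (N + 1) :=
      mul_le_mul (le_abs_self _) (by linarith) hN (abs_nonneg _)
    have h5 := hw N
    calc _ ≤ _ := h1
      _ ≤ _ := by linarith

end Stability

/-! ### Least squares -/

section LeastSquares

lemma rank_eq_iff_injective {I : Type*} {p : ℕ} {A : Matrix I (Fin p) ℝ} :
    A.rank = p ↔ Function.Injective A.mulVec := by
  have h := A.mulVecLin.finrank_range_add_finrank_ker
  rw [Module.finrank_fin_fun] at h
  change A.rank + _ = p at h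
  have e : Function.Injective A.mulVec ↔ LinearMap.ker A.mulVecLin = ⊥ := by
    rw [LinearMap.ker_eq_bot]; rfl
  rw [e, ← Submodule.finrank_eq_zero]
  omega

variable {I : Type*} [Fintype I] {p : ℕ} {A : Matrix I (Fin p) ℝ}

/-- The least-squares coefficients `(Aᵀ A)⁻¹ Aᵀ v`. -/
noncomputable def lsq (A : Matrix I (Fin p) ℝ) (v : I → ℝ) : Vec p :=
  WithLp.toLp 2 ((Aᵀ * A)⁻¹ *ᵥ (Aᵀ *ᵥ v))

lemma lsq_sub (v w : I → ℝ) : lsq A (v - w) = lsq A v - lsq A w := by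
  simp [lsq, Matrix.mulVec_sub]

lemma lsq_add (v w : I → ℝ) : lsq A (v + w) = lsq A v + lsq A w := by
  simp [lsq, Matrix.mulVec_add]

lemma lsq_mulVec (hA : IsUnit (Aᵀ * A).det) (b : Vec p) : lsq A (A *ᵥ b.ofLp) = b := by
  unfold lsq
  rw [Matrix.mulVec_mulVec, Matrix.mulVec_mulVec, Matrix.mul_assoc, Matrix.nonsing_inv_mul _ hA, Matrix.one_mulVec]

lemma mulVec_dotProduct_sub_lsq (hA : IsUnit (Aᵀ * A).det) (v : I → ℝ) (b : Vec p) :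
    (A *ᵥ b.ofLp) ⬝ᵥ (v - A *ᵥ (lsq A v).ofLp) = 0 := by
  have h : Aᵀ *ᵥ (v - A *ᵥ (lsq A v).ofLp) = 0 := by
    unfold lsq
    rw [Matrix.mulVec_sub, Matrix.mulVec_mulVec _ Aᵀ A, Matrix.mulVec_mulVec _ (Aᵀ * A),
      Matrix.mul_nonsing_inv _ hA, Matrix.one_mulVec, sub_self]
  rw [dotProduct_comm, Matrix.dotProduct_mulVec, ← Matrix.mulVec_transpose, h, zero_dotProduct]

/-- Pythagoras for the least-squares fit and its residual. -/
lemma sum_sq_eq_lsq (hA : IsUnit (Aᵀ * A).det) (v : I → ℝ) :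
    ∑ s, v s ^ 2 = ∑ s, (A *ᵥ (lsq A v).ofLp) s ^ 2 + ∑ s, (v - A *ᵥ (lsq A v).ofLp) s ^ 2 := by
  have h := mulVec_dotProduct_sub_lsq hA v (lsq A v)
  rw [dotProduct] at h
  have : ∀ s, v s ^ 2 = (A *ᵥ (lsq A v).ofLp) s ^ 2 + (v - A *ᵥ (lsq A v).ofLp) s ^ 2 +
      2 * ((A *ᵥ (lsq A v).ofLp) s * (v - A *ᵥ (lsq A v).ofLp) s) := by
    intro s; simp only [Pi.sub_apply]; ring
  simp_rw [this]
  rw [Finset.sum_add_distrib, ← Finset.mul_sum, h, mul_zero, add_zero, Finset.sum_add_distrib]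

lemma isUnit_det_gram (hA : Function.Injective A.mulVec) : IsUnit (Aᵀ * A).det := by
  rw [← Matrix.isUnit_iff_isUnit_det, ← Matrix.mulVec_injective_iff_isUnit]
  intro v w h
  apply hA
  rw [← sub_eq_zero, ← Matrix.mulVec_sub]
  have h0 : (Aᵀ * A) *ᵥ (v - w) = 0 := by rw [Matrix.mulVec_sub, sub_eq_zero]; exact h
  have h1 : (A *ᵥ (v - w)) ⬝ᵥ (A *ᵥ (v - w)) = 0 := by
    rw [Matrix.dotProduct_mulVec, ← Matrix.mulVec_transpose, Matrix.mulVec_mulVec, h0,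
      zero_dotProduct]
  exact dotProduct_self_eq_zero.1 h1

end LeastSquares

/-! ### Averages of stacked signals -/

section Averages

variable {ny : ℕ}

/-- The first `N` terms of a signal as one stacked vector. -/
def stack (N : ℕ) (g : ℕ → Vec ny) : Fin N × Fin ny → ℝ := fun s => g s.1 s.2

/-- The mean square `(1/N) ‖v‖²` of a stacked vector. -/
noncomputable def meanSq {N : ℕ} (v : Fin N × Fin ny → ℝ) : ℝ := (N : ℝ)⁻¹ * ∑ s, v s ^ 2

/-- The average inner product `(1/N) ⟨v, w⟩` of stacked vectors. -/
noncomputable def meanIP {N : ℕ} (v w : Fin N × Fin ny → ℝ) : ℝ := (N : ℝ)⁻¹ * ∑ s, v s * w s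

variable {N : ℕ}

lemma meanSq_nonneg (v : Fin N × Fin ny → ℝ) : 0 ≤ meanSq v :=
  mul_nonneg (by positivity) (Finset.sum_nonneg fun _ _ => sq_nonneg _)

lemma meanSq_sub_le (v w : Fin N × Fin ny → ℝ) : meanSq (v - w) ≤ 2 * meanSq v + 2 * meanSq w := by
  have h : ∑ s, (v - w) s ^ 2 ≤ 2 * ∑ s, v s ^ 2 + 2 * ∑ s, w s ^ 2 := by
    rw [Finset.mul_sum, Finset.mul_sum, ← Finset.sum_add_distrib]
    refine Finset.sum_le_sum fun s _ => ?_
    simp only [Pi.sub_apply]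
    nlinarith [sq_nonneg (v s + w s)]
  have := mul_le_mul_of_nonneg_left h (by positivity : 0 ≤ (N : ℝ)⁻¹)
  unfold meanSq
  linarith

lemma meanSq_neg (v : Fin N × Fin ny → ℝ) : meanSq (-v) = meanSq v := by simp [meanSq]

lemma meanSq_add_le (v w : Fin N × Fin ny → ℝ) : meanSq (v + w) ≤ 2 * meanSq v + 2 * meanSq w := by
  have := meanSq_sub_le v (-w)
  rwa [sub_neg_eq_add, meanSq_neg] at this

lemma meanSq_sub_eq (v w : Fin N × Fin ny → ℝ) :
    meanSq (v - w) = meanSq v - 2 * meanIP v w + meanSq w := by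
  have h : ∑ s, (v - w) s ^ 2 = ∑ s, v s ^ 2 - 2 * ∑ s, v s * w s + ∑ s, w s ^ 2 := by
    rw [Finset.mul_sum, ← Finset.sum_sub_distrib, ← Finset.sum_add_distrib]
    refine Finset.sum_congr rfl fun s _ => ?_
    simp only [Pi.sub_apply]
    ring
  unfold meanSq meanIP
  rw [h]; ring

lemma meanIP_add_right (v w z : Fin N × Fin ny → ℝ) : meanIP v (w + z) = meanIP v w + meanIP v z := by
  simp only [meanIP, Pi.add_apply, mul_add, Finset.sum_add_distrib]

lemma meanIP_sub_right (v w z : Fin N × Fin ny → ℝ) : meanIP v (w - z) = meanIP v w - meanIP v z := by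
  simp only [meanIP, Pi.sub_apply, mul_sub, Finset.sum_sub_distrib]

lemma meanIP_self (v : Fin N × Fin ny → ℝ) : meanIP v v = meanSq v := by
  simp only [meanIP, meanSq, sq]

lemma abs_meanIP_le (v w : Fin N × Fin ny → ℝ) : |meanIP v w| ≤ √(meanSq v * meanSq w) := by
  refine Real.abs_le_sqrt ?_
  unfold meanIP meanSq
  have h := Finset.sum_mul_sq_le_sq_mul_sq Finset.univ v w
  have := mul_le_mul_of_nonneg_left h (sq_nonneg (N : ℝ)⁻¹)
  calc _ = ((N : ℝ)⁻¹) ^ 2 * (∑ s, v s * w s) ^ 2 := by ring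
    _ ≤ _ := this
    _ = _ := by ring

lemma meanSq_stack (g : ℕ → Vec ny) :
    meanSq (stack N g) = (N : ℝ)⁻¹ * ∑ i ∈ Finset.range N, ‖g i‖ ^ 2 := by
  unfold meanSq stack
  rw [Fintype.sum_prod_type, ← Fin.sum_univ_eq_sum_range (fun i => ‖g i‖ ^ 2)]
  simp_rw [EuclideanSpace.real_norm_sq_eq]

lemma meanIP_stack (g h : ℕ → Vec ny) :
    meanIP (stack N g) (stack N h) = ∑ j, (N : ℝ)⁻¹ * ∑ i ∈ Finset.range N, g i j * h i j := by
  unfold meanIP stack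
  rw [Fintype.sum_prod_type, Finset.sum_comm, Finset.mul_sum]
  refine Finset.sum_congr rfl fun j _ => ?_
  rw [← Fin.sum_univ_eq_sum_range (fun i => g i j * h i j)]

lemma meanSq_stack_le_of_power {g : ℕ → Vec ny} {B : ℝ} (hB : 0 ≤ B)
    (hg : ∀ N : ℕ, ∑ i ∈ Finset.range N, ‖g i‖ ^ 2 ≤ B * N) (N : ℕ) : meanSq (stack N g) ≤ B := by
  rw [meanSq_stack]
  rcases Nat.eq_zero_or_pos N with rfl | hN
  · simpa using hB
  · have : (0 : ℝ) < N := by exact_mod_cast hN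
    rw [inv_mul_le_iff₀ this, mul_comm]
    exact hg N

/-- Signals that grow at most linearly in a signal of finite average power. -/
lemma meanSq_stack_le_of_growth {E : Type*} [NormedAddCommGroup E] {x : ℕ → E} {g : ℕ → Vec ny}
    {B c : ℝ} (hB : 0 ≤ B)
    (hx : ∀ N : ℕ, ∑ i ∈ Finset.range N, ‖x i‖ ^ 2 ≤ B * N)
    (hg : ∀ i, ‖g i‖ ≤ c * (1 + ‖x i‖)) (N : ℕ) : meanSq (stack N g) ≤ 2 * c ^ 2 * (1 + B) := by
  refine meanSq_stack_le_of_power (by positivity) (fun N => ?_) N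
  have h1 : ∀ i ∈ Finset.range N, ‖g i‖ ^ 2 ≤ 2 * c ^ 2 * (1 + ‖x i‖ ^ 2) := fun i _ => by
    have h2 := pow_le_pow_left₀ (norm_nonneg _) (hg i) 2
    have h3 : (1 + ‖x i‖) ^ 2 ≤ 2 * (1 + ‖x i‖ ^ 2) := by nlinarith [sq_nonneg (1 - ‖x i‖)]
    have h4 := mul_le_mul_of_nonneg_left h3 (sq_nonneg c)
    rw [mul_pow] at h2
    linarith
  refine (Finset.sum_le_sum h1).trans ?_
  rw [← Finset.mul_sum, Finset.sum_add_distrib]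
  simp only [Finset.sum_const, Finset.card_range, nsmul_eq_mul, mul_one]
  have := mul_le_mul_of_nonneg_left (hx N) (by positivity : 0 ≤ 2 * c ^ 2)
  linarith

variable {ι : Type*} {l : Filter ι} {n : ι → ℕ}

lemma tendsto_meanSq_of_le {v : ∀ k, Fin (n k) × Fin ny → ℝ} {a : ι → ℝ}
    (h : ∀ᶠ k in l, meanSq (v k) ≤ a k) (ha : Tendsto a l (𝓝 0)) :
    Tendsto (fun k => meanSq (v k)) l (𝓝 0) :=
  squeeze_zero' (Eventually.of_forall fun _ => meanSq_nonneg _) h ha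

lemma tendsto_meanSq_sub {v w : ∀ k, Fin (n k) × Fin ny → ℝ}
    (hv : Tendsto (fun k => meanSq (v k)) l (𝓝 0)) (hw : Tendsto (fun k => meanSq (w k)) l (𝓝 0)) :
    Tendsto (fun k => meanSq (v k - w k)) l (𝓝 0) :=
  tendsto_meanSq_of_le (Eventually.of_forall fun _ => meanSq_sub_le _ _)
    (by simpa using (hv.const_mul 2).add (hw.const_mul 2))

lemma tendsto_meanIP_of_bounded {v w : ∀ k, Fin (n k) × Fin ny → ℝ} {B : ℝ}
    (hv : ∀ k, meanSq (v k) ≤ B) (hw : Tendsto (fun k => meanSq (w k)) l (𝓝 0)) :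
    Tendsto (fun k => meanIP (v k) (w k)) l (𝓝 0) := by
  refine squeeze_zero_norm (a := fun k => √(B * meanSq (w k))) (fun k => ?_) ?_
  · exact (abs_meanIP_le _ _).trans
      (Real.sqrt_le_sqrt (mul_le_mul_of_nonneg_right (hv k) (meanSq_nonneg _)))
  · simpa using (hw.const_mul B).sqrt

/-- If prediction errors `d k` beat the prediction errors `s k` of asymptotically vanishing mean
square in the presence of a noise to which `d k` is asymptotically orthogonal, then their mean
square vanishes, too. -/
lemma tendsto_meanSq_of_le_noise {E d s : ∀ k, Fin (n k) × Fin ny → ℝ} {B : ℝ}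
    (hE : ∀ k, meanSq (E k) ≤ B) (hs : Tendsto (fun k => meanSq (s k)) l (𝓝 0))
    (hd : Tendsto (fun k => meanIP (E k) (d k)) l (𝓝 0))
    (hle : ∀ᶠ k in l, meanSq (E k - d k) ≤ meanSq (E k - s k)) :
    Tendsto (fun k => meanSq (d k)) l (𝓝 0) := by
  refine tendsto_meanSq_of_le (a := fun k => 2 * meanIP (E k) (d k) - 2 * meanIP (E k) (s k) +
    meanSq (s k)) ?_ ?_
  · filter_upwards [hle] with k hk
    rw [meanSq_sub_eq, meanSq_sub_eq] at hk
    linarith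
  · simpa using ((hd.const_mul 2).sub ((tendsto_meanIP_of_bounded hE hs).const_mul 2)).add hs

end Averages

/-! ### Asymptotics along one realization -/

namespace Components

variable {na nb ny nu p q : ℕ} (M : Components na nb ny nu p q)

lemma Phi_mulVec (x : ℕ → Reg na nb ny nu) (N : ℕ) (b : Vec p) :
    M.Phi (fun i : Fin N => x i) *ᵥ b.ofLp = stack N fun i => M.base b (x i) := rfl

lemma stack_osa (x : ℕ → Reg na nb ny nu) (N : ℕ) (θ : Par p q) :
    stack N (fun i => M.osa θ 0 (x i)) =
      M.Phi (fun i : Fin N => x i) *ᵥ θ.1.ofLp + M.F (fun i : Fin N => x i) θ.2 := by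
  funext s
  simp [stack, osa, base, F, Phi, Matrix.mulVec, dotProduct]

lemma thetaAux_eq_lsq {N : ℕ} (x : Fin N → Reg na nb ny nu) (a : Vec q) :
    M.thetaAux x a = lsq (M.Phi x) (M.F x a) := rfl

/-- The orthogonalized prediction is the baseline prediction plus the least-squares residual of the
prediction of the model with auxiliary parameter `0`. -/
lemma pred_eq_residual {N : ℕ} {x : ℕ → Reg na nb ny nu}
    (hx : IsUnit ((M.Phi fun i : Fin N => x i)ᵀ * M.Phi fun i : Fin N => x i).det) (θ : Par p q) :
    M.pred (fun i : Fin N => x i) θ =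
      (stack N (fun i => M.osa θ 0 (x i)) - M.Phi (fun i : Fin N => x i) *ᵥ
        (lsq (M.Phi fun i : Fin N => x i) (stack N fun i => M.osa θ 0 (x i))).ofLp) +
      M.Phi (fun i : Fin N => x i) *ᵥ θ.1.ofLp := by
  rw [stack_osa, lsq_add, lsq_mulVec hx, pred, thetaAux_eq_lsq, WithLp.ofLp_add, Matrix.mulVec_add]
  abel

lemma cost_eq_meanSq {N : ℕ} (x : Fin N → Reg na nb ny nu) (y : ℕ → Vec ny) (θ : Par p q) :
    M.cost x (fun i => y i) θ = meanSq (stack N y - M.pred x θ) := rfl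

variable {M} {x : ℕ → Reg na nb ny nu} {B C κ : ℝ}

lemma meanSq_base_le (hB : 0 ≤ B) (hx : ∀ N : ℕ, ∑ i ∈ Finset.range N, ‖x i‖ ^ 2 ≤ B * N)
    (hgrow : ∀ b x, ‖M.base b x‖ ≤ C * ‖b‖ * (1 + ‖x‖)) (N : ℕ) (b : Vec p) :
    meanSq (M.Phi (fun i : Fin N => x i) *ᵥ b.ofLp) ≤ 2 * C ^ 2 * (1 + B) * ‖b‖ ^ 2 := by
  rw [Phi_mulVec]
  refine (meanSq_stack_le_of_growth hB hx (fun i => hgrow b (x i)) N).trans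
    (le_of_eq ?_)
  ring

/-- Excitation of every single direction is uniform, by compactness of the unit sphere. -/
lemma exists_uniform_excitation (hB : 0 ≤ B)
    (hx : ∀ N : ℕ, ∑ i ∈ Finset.range N, ‖x i‖ ^ 2 ≤ B * N)
    (hgrow : ∀ b x, ‖M.base b x‖ ≤ C * ‖b‖ * (1 + ‖x‖))
    (hexc : ∀ b : Vec p, b ≠ 0 → ∃ c : ℝ, 0 < c ∧ ∀ᶠ N : ℕ in atTop,
      c ≤ meanSq (M.Phi (fun i : Fin N => x i) *ᵥ b.ofLp)) :
    ∃ κ : ℝ, 0 < κ ∧ ∀ᶠ N : ℕ in atTop, ∀ b : Vec p,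
      κ * ‖b‖ ^ 2 ≤ meanSq (M.Phi (fun i : Fin N => x i) *ᵥ b.ofLp) := by
  obtain ⟨κ, hκ, h⟩ : ∃ κ : ℝ, 0 < κ ∧ ∀ᶠ N : ℕ in atTop, ∀ b ∈ Metric.sphere (0 : Vec p) 1,
      κ ≤ meanSq (M.Phi (fun i : Fin N => x i) *ᵥ b.ofLp) := by
    refine (isCompact_sphere (0 : Vec p) 1).induction_on (p := fun S => ∃ κ : ℝ, 0 < κ ∧
      ∀ᶠ N : ℕ in atTop, ∀ b ∈ S, κ ≤ meanSq (M.Phi (fun i : Fin N => x i) *ᵥ b.ofLp))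
      ⟨1, one_pos, by simp⟩ ?_ ?_ ?_
    · rintro S T hST ⟨κ, hκ, h⟩
      exact ⟨κ, hκ, h.mono fun N hN b hb => hN b (hST hb)⟩
    · rintro S T ⟨κ, hκ, h⟩ ⟨κ', hκ', h'⟩
      refine ⟨min κ κ', lt_min hκ hκ', ?_⟩
      filter_upwards [h, h'] with N h1 h2 b hb
      rcases hb with hb | hb
      · exact (min_le_left _ _).trans (h1 b hb)
      · exact (min_le_right _ _).trans (h2 b hb)
    · intro b hb
      have hb0 : b ≠ 0 := by
        rintro rfl; simp at hb
      obtain ⟨c, hc, h⟩ := hexc b hb0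
      set K := 2 * C ^ 2 * (1 + B) with hK
      have hK0 : 0 ≤ K := by positivity
      have hr : 0 < √(c / (4 * (K + 1))) := Real.sqrt_pos.2 (by positivity)
      refine ⟨Metric.ball b √(c / (4 * (K + 1))),
        mem_nhdsWithin_of_mem_nhds (Metric.ball_mem_nhds b hr), c / 4, by positivity, ?_⟩
      filter_upwards [h] with N hN b' hb'
      -- `‖Φ b‖² ≤ 2 ‖Φ b'‖² + 2 ‖Φ (b' - b)‖²`, and the last term is small near `b`.
      have h1 := meanSq_sub_le (M.Phi (fun i : Fin N => x i) *ᵥ b'.ofLp)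
        (M.Phi (fun i : Fin N => x i) *ᵥ (b' - b).ofLp)
      rw [← Matrix.mulVec_sub, WithLp.ofLp_sub, sub_sub_cancel] at h1
      have h2 := meanSq_base_le hB hx hgrow N (b' - b)
      rw [WithLp.ofLp_sub] at h2
      rw [Metric.mem_ball, dist_eq_norm] at hb'
      have h3 := pow_le_pow_left₀ (norm_nonneg _) hb'.le 2
      rw [Real.sq_sqrt (by positivity), le_div_iff₀ (by positivity)] at h3
      nlinarith [sq_nonneg ‖b' - b‖]
  refine ⟨κ, hκ, h.mono fun N hN b => ?_⟩
  rcases eq_or_ne b 0 with rfl | hb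
  · simpa using meanSq_nonneg _
  have hb' : ‖b‖ ≠ 0 := norm_ne_zero_iff.2 hb
  have h1 := hN (‖b‖⁻¹ • b) (by simp [norm_smul, hb'])
  have h2 : meanSq (M.Phi (fun i : Fin N => x i) *ᵥ (‖b‖⁻¹ • b).ofLp) =
      (‖b‖⁻¹) ^ 2 * meanSq (M.Phi (fun i : Fin N => x i) *ᵥ b.ofLp) := by
    rw [WithLp.ofLp_smul, Matrix.mulVec_smul]
    simp only [meanSq, Pi.smul_apply, smul_eq_mul, mul_pow, ← Finset.mul_sum]
    ring
  rw [h2, inv_pow, inv_mul_eq_div, le_div_iff₀ (by positivity)] at h1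
  exact h1

lemma injective_of_excitation (hκ : 0 < κ) {N : ℕ}
    (h : ∀ b : Vec p, κ * ‖b‖ ^ 2 ≤ meanSq (M.Phi (fun i : Fin N => x i) *ᵥ b.ofLp)) :
    Function.Injective (M.Phi fun i : Fin N => x i).mulVec := by
  intro v w hvw
  have h1 := h (WithLp.toLp 2 (v - w))
  have h2 : M.Phi (fun i : Fin N => x i) *ᵥ (WithLp.toLp 2 (v - w) : Vec p).ofLp = 0 := by
    rw [WithLp.ofLp_toLp, Matrix.mulVec_sub, sub_eq_zero]; exact hvw
  rw [h2] at h1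
  have h3 : meanSq (0 : Fin N × Fin ny → ℝ) = 0 := by simp [meanSq]
  rw [h3] at h1
  have h4 : ‖(WithLp.toLp 2 (v - w) : Vec p)‖ ^ 2 = 0 := by
    nlinarith [sq_nonneg ‖(WithLp.toLp 2 (v - w) : Vec p)‖]
  have h5 : (WithLp.toLp 2 (v - w) : Vec p) = 0 := by simpa using h4
  have h6 := congrArg WithLp.ofLp h5
  exact sub_eq_zero.1 (by simpa using h6)

lemma isUnit_of_excitation (hκ : 0 < κ) {N : ℕ}
    (h : ∀ b : Vec p, κ * ‖b‖ ^ 2 ≤ meanSq (M.Phi (fun i : Fin N => x i) *ᵥ b.ofLp)) :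
    IsUnit ((M.Phi fun i : Fin N => x i)ᵀ * M.Phi fun i : Fin N => x i).det :=
  isUnit_det_gram (injective_of_excitation hκ h)

lemma meanSq_residual_le {N : ℕ} {A : Matrix (Fin N × Fin ny) (Fin p) ℝ} (hA : IsUnit (Aᵀ * A).det)
    (v : Fin N × Fin ny → ℝ) : meanSq (v - A *ᵥ (lsq A v).ofLp) ≤ meanSq v := by
  unfold meanSq
  rw [sum_sq_eq_lsq hA v]
  refine mul_le_mul_of_nonneg_left ?_ (by positivity)
  have : 0 ≤ ∑ s, (A *ᵥ (lsq A v).ofLp) s ^ 2 := Finset.sum_nonneg fun _ _ => sq_nonneg _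
  linarith

lemma meanSq_fit_le {N : ℕ} {A : Matrix (Fin N × Fin ny) (Fin p) ℝ} (hA : IsUnit (Aᵀ * A).det)
    (v : Fin N × Fin ny → ℝ) : meanSq (A *ᵥ (lsq A v).ofLp) ≤ meanSq v := by
  unfold meanSq
  rw [sum_sq_eq_lsq hA v]
  refine mul_le_mul_of_nonneg_left ?_ (by positivity)
  have : 0 ≤ ∑ s, (v - A *ᵥ (lsq A v).ofLp) s ^ 2 := Finset.sum_nonneg fun _ _ => sq_nonneg _
  linarith

/-- A signal that is asymptotically orthogonal to every column of `φ(x_i)` is asymptotically orthogonal to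
`Φ v_k` for a bounded sequence of coefficients `v_k`. -/
lemma tendsto_meanIP_Phi {E : ℕ → Vec ny} {n : ℕ → ℕ} (hn : Tendsto n atTop atTop)
    (hE : ∀ l, Tendsto (fun N => meanIP (stack N E)
      (stack N fun i => M.base (EuclideanSpace.single l (1 : ℝ)) (x i))) atTop (𝓝 0))
    {v : ℕ → Vec p} {K : ℝ} (hv : ∀ᶠ k in atTop, ‖v k‖ ≤ K) :
    Tendsto (fun k => meanIP (stack (n k) E) (M.Phi (fun i : Fin (n k) => x i) *ᵥ (v k).ofLp))
      atTop (𝓝 0) := by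
  have e : ∀ k, meanIP (stack (n k) E) (M.Phi (fun i : Fin (n k) => x i) *ᵥ (v k).ofLp) =
      ∑ l, v k l * meanIP (stack (n k) E)
        (stack (n k) fun i => M.base (EuclideanSpace.single l (1 : ℝ)) (x i)) := by
    intro k
    have h1 : ∀ s, (M.Phi (fun i : Fin (n k) => x i) *ᵥ (v k).ofLp) s =
        ∑ l, v k l * stack (n k) (fun i => M.base (EuclideanSpace.single l (1 : ℝ)) (x i)) s := by
      intro s
      simp [stack, base, Phi, Matrix.mulVec, dotProduct, mul_comm]
    unfold meanIP
    simp_rw [h1, Finset.mul_sum]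
    rw [Finset.sum_comm]
    refine Finset.sum_congr rfl fun l _ => Finset.sum_congr rfl fun s _ => ?_
    ring
  simp_rw [e]
  rw [show (0 : ℝ) = ∑ l : Fin p, 0 by simp]
  refine tendsto_finsetSum _ fun l _ => ?_
  refine bdd_le_mul_tendsto_zero' K ?_ ((hE _).comp hn)
  filter_upwards [hv] with k hk
  exact (PiLp.norm_apply_le (v k) l).trans hk

end Components

namespace Components

variable {na nb ny nu p q : ℕ} {M : Components na nb ny nu p q} {Θ : Set (Par p q)}

/-- The properties of a realization of regressors `x` and noise `e` on which consistency rests: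
finite average power, noise asymptotically orthogonal to the predictors and to the baseline, and a
uniformly well-conditioned baseline. -/
structure Typical (M : Components na nb ny nu p q) (Θ : Set (Par p q)) (x : ℕ → Reg na nb ny nu)
    (e : ℕ → Vec ny) : Prop where
  power : ∃ B : ℝ, 0 ≤ B ∧ ∀ N : ℕ, ∑ i ∈ Finset.range N, ‖x i‖ ^ 2 ≤ B * N
  noise : ∃ B : ℝ, ∀ N : ℕ, meanSq (stack N e) ≤ B
  osa_law : ∀ θ ∈ Θ, Tendsto (fun N => meanIP (stack N e) (stack N fun i => M.osa θ 0 (x i)))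
    atTop (𝓝 0)
  base_law : ∀ l, Tendsto (fun N => meanIP (stack N e)
    (stack N fun i => M.base (EuclideanSpace.single l (1 : ℝ)) (x i))) atTop (𝓝 0)
  excited : ∃ κ : ℝ, 0 < κ ∧ ∀ᶠ N : ℕ in atTop, ∀ b : Vec p,
    κ * ‖b‖ ^ 2 ≤ meanSq (M.Phi (fun i : Fin N => x i) *ᵥ b.ofLp)

variable {x : ℕ → Reg na nb ny nu} {e : ℕ → Vec ny}

lemma Typical.eventually_isUnit (h : M.Typical Θ x e) : ∀ᶠ N : ℕ in atTop,
    IsUnit ((M.Phi fun i : Fin N => x i)ᵀ * M.Phi fun i : Fin N => x i).det := by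
  obtain ⟨κ, hκ, h⟩ := h.excited
  exact h.mono fun N hN => isUnit_of_excitation hκ hN

lemma Typical.exists_rank_eq (h : M.Typical Θ x e) :
    ∃ (N : ℕ) (z : Fin N → Reg na nb ny nu), (M.Phi z).rank = p := by
  obtain ⟨κ, hκ, h⟩ := h.excited
  obtain ⟨N, hN⟩ := h.exists
  exact ⟨N, _, rank_eq_iff_injective.2 (injective_of_excitation hκ hN)⟩

/-- A change of the auxiliary parameter shifts the stacked predictor by a baseline signal. -/
lemma stack_osa_eq (x : ℕ → Reg na nb ny nu) (N : ℕ) (θ : Par p q) (c : Vec p) :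
    stack N (fun i => M.osa θ c (x i)) =
      stack N (fun i => M.osa θ 0 (x i)) - M.Phi (fun i : Fin N => x i) *ᵥ c.ofLp := by
  rw [Phi_mulVec]
  funext s
  simp only [stack, Pi.sub_apply]
  rw [osa_eq_sub_base]
  rfl

/-- If parameters `θ_k → θ` do at least as well as a true parameter `θ₀` on the data of lengths
`n_k → ∞`, then the predictions of `θ` and `θ₀` agree in mean square along these lengths. -/
lemma Typical.tendsto_meanSq_pred_sub (h : M.Typical Θ x e) (hpred : M.StablePredictor Θ)
    {θ₀ : Par p q} (hθ₀ : θ₀ ∈ Θ) {c : Vec p}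
    (haux : Tendsto (fun N : ℕ => M.thetaAux (fun i : Fin N => x i) θ₀.2) atTop (𝓝 c))
    {y : ℕ → Vec ny} (hy : ∀ i, y i = M.osa θ₀ c (x i) + e i)
    {n : ℕ → ℕ} (hn : Tendsto n atTop atTop) {θs : ℕ → Par p q} {θ : Par p q} (hθ : θ ∈ Θ)
    (hlim : Tendsto θs atTop (𝓝 θ))
    (hmin : ∀ᶠ k in atTop, M.cost (fun i : Fin (n k) => x i) (fun i => y i) (θs k) ≤
      M.cost (fun i : Fin (n k) => x i) (fun i => y i) θ₀) :
    Tendsto (fun k => meanSq (M.pred (fun i : Fin (n k) => x i) θ -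
      M.pred (fun i : Fin (n k) => x i) θ₀)) atTop (𝓝 0) := by
  obtain ⟨B, hB, hx⟩ := h.power
  obtain ⟨Be, hBe⟩ := h.noise
  obtain ⟨κ, hκ, hexc⟩ := h.excited
  obtain ⟨C, hC, hgrow⟩ := hpred.base_growth ⟨θ₀, hθ₀⟩
  have hunit := hn.eventually h.eventually_isUnit
  have hexc := hn.eventually hexc
  let A : ∀ k, Matrix (Fin (n k) × Fin ny) (Fin p) ℝ := fun k => M.Phi fun i : Fin (n k) => x i
  let G : Par p q → ∀ k, Fin (n k) × Fin ny → ℝ := fun t k => stack (n k) fun i => M.osa t 0 (x i)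
  let D : Par p q → ∀ k, Fin (n k) × Fin ny → ℝ := fun t k => M.pred (fun i : Fin (n k) => x i) t
  have hres : ∀ᶠ k in atTop, ∀ t, D t k = (G t k - A k *ᵥ (lsq (A k) (G t k)).ofLp) +
      A k *ᵥ t.1.ofLp := hunit.mono fun k hk t => M.pred_eq_residual hk t
  have hbase : ∀ k (b : Vec p), meanSq (A k *ᵥ b.ofLp) ≤ 2 * C ^ 2 * (1 + B) * ‖b‖ ^ 2 :=
    fun k b => meanSq_base_le hB hx hgrow (n k) b
  -- continuity of the predictions in the parameter, in mean square
  have hG : Tendsto (fun k => meanSq (G (θs k) k - G θ k)) atTop (𝓝 0) := by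
    refine tendsto_order.2 ⟨fun a ha => Eventually.of_forall fun k => ha.trans_le (meanSq_nonneg _),
      fun a ha => ?_⟩
    have hε : 0 < √(a / (4 * (1 + B))) := Real.sqrt_pos.2 (by positivity)
    obtain ⟨r, hr, heq⟩ := hpred.osa_equicontinuous hθ hε
    filter_upwards [Metric.tendsto_nhds.1 hlim r hr] with k hk
    have h1 := meanSq_stack_le_of_growth hB hx
      (g := fun i => M.osa (θs k) 0 (x i) - M.osa θ 0 (x i)) (fun i => heq _ hk (x i)) (n k)
    rw [Real.sq_sqrt (by positivity)] at h1
    have e1 : 2 * (a / (4 * (1 + B))) * (1 + B) = a / 2 := by field_simp; ring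
    rw [e1] at h1
    exact h1.trans_lt (half_lt_self ha)
  have hr : Tendsto (fun k => meanSq (D (θs k) k - D θ k)) atTop (𝓝 0) := by
    refine tendsto_meanSq_of_le (a := fun k => 2 * meanSq (G (θs k) k - G θ k) +
      2 * (2 * C ^ 2 * (1 + B) * ‖(θs k).1 - θ.1‖ ^ 2)) ?_ ?_
    · filter_upwards [hres, hunit] with k hk hu
      have e1 : D (θs k) k - D θ k = (G (θs k) k - G θ k - A k *ᵥ
          (lsq (A k) (G (θs k) k - G θ k)).ofLp) + A k *ᵥ ((θs k).1 - θ.1).ofLp := by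
        rw [hk, hk, lsq_sub, WithLp.ofLp_sub, WithLp.ofLp_sub, Matrix.mulVec_sub, Matrix.mulVec_sub]
        abel
      rw [e1]
      refine (meanSq_add_le _ _).trans ?_
      have h1 := meanSq_residual_le (A := A k) hu (G (θs k) k - G θ k)
      have h2 := hbase k ((θs k).1 - θ.1)
      linarith
    · have h1 : Tendsto (fun k => ‖(θs k).1 - θ.1‖) atTop (𝓝 0) := by
        have := (continuous_fst.tendsto θ).comp hlim
        exact tendsto_iff_norm_sub_tendsto_zero.1 this
      simpa using (hG.const_mul 2).add (((h1.pow 2).const_mul (2 * C ^ 2 * (1 + B))).const_mul 2)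
  -- the true parameter predicts the noise-free output asymptotically
  let S : ∀ k, Fin (n k) × Fin ny → ℝ := fun k => stack (n k) fun i => M.osa θ₀ c (x i)
  have hS : ∀ k, S k = G θ₀ k - A k *ᵥ c.ofLp := fun k => stack_osa_eq x (n k) θ₀ c
  have hs : Tendsto (fun k => meanSq (D θ₀ k - S k)) atTop (𝓝 0) := by
    refine tendsto_meanSq_of_le (a := fun k => 2 * C ^ 2 * (1 + B) *
      ‖c - M.thetaAux (fun i : Fin (n k) => x i) θ₀.2‖ ^ 2) (Eventually.of_forall fun k => ?_) ?_
    · have e1 : D θ₀ k - S k = A k *ᵥ (c - M.thetaAux (fun i : Fin (n k) => x i) θ₀.2).ofLp := by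
        rw [hS]
        simp only [D, G, A]
        rw [stack_osa, pred, WithLp.ofLp_sub, Matrix.mulVec_sub]
        abel
      rw [e1]
      exact hbase k _
    · have h1 := tendsto_iff_norm_sub_tendsto_zero.1 (haux.comp hn)
      simp_rw [norm_sub_rev c]
      simpa using (h1.pow 2).const_mul (2 * C ^ 2 * (1 + B))
  -- the noise is asymptotically orthogonal to the prediction error of the limit parameter
  have hE : ∀ k, meanSq (stack (n k) e) ≤ Be := fun k => hBe (n k)
  have horth : Tendsto (fun k => meanIP (stack (n k) e) (D θ k - S k)) atTop (𝓝 0) := by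
    obtain ⟨Cg, hCg, hgr⟩ := hpred.osa_growth hθ 0
    have hGb : ∀ k, meanSq (G θ k) ≤ 2 * Cg ^ 2 * (1 + B) := fun k =>
      meanSq_stack_le_of_growth hB hx (fun i => hgr (x i)) (n k)
    have hl : ∀ᶠ k in atTop, ‖lsq (A k) (G θ k)‖ ≤ √(2 * Cg ^ 2 * (1 + B) / κ) := by
      filter_upwards [hunit, hexc] with k hu hk
      refine Real.le_sqrt_of_sq_le ?_
      rw [le_div_iff₀ hκ, mul_comm]
      exact (hk _).trans ((meanSq_fit_le (A := A k) hu _).trans (hGb k))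
    have h1 := tendsto_meanIP_Phi (M := M) (x := x) hn h.base_law hl
    have h2 := tendsto_meanIP_Phi (M := M) (x := x) hn h.base_law (v := fun _ => θ.1 + c)
      (Eventually.of_forall fun _ => le_rfl)
    have h3 := (h.osa_law θ hθ).comp hn
    have h4 := (h.osa_law θ₀ hθ₀).comp hn
    have h5 := ((h3.sub h1).add h2).sub h4
    simp only [sub_zero, add_zero] at h5
    refine h5.congr' ?_
    filter_upwards [hres] with k hk
    have e1 : D θ k - S k = (G θ k - A k *ᵥ (lsq (A k) (G θ k)).ofLp) +
        A k *ᵥ (θ.1 + c).ofLp - G θ₀ k := by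
      rw [hk, hS, WithLp.ofLp_add, Matrix.mulVec_add]; abel
    rw [e1, meanIP_sub_right, meanIP_add_right, meanIP_sub_right]
    rfl
  have hd := tendsto_meanSq_of_le_noise (n := n) (E := fun k => stack (n k) e)
    (d := fun k => D (θs k) k - S k) (s := fun k => D θ₀ k - S k) hE hs
    (by
      have := horth.add (tendsto_meanIP_of_bounded hE hr)
      rw [add_zero] at this
      refine this.congr fun k => ?_
      rw [← meanIP_add_right]
      congr 1
      abel)
    (by
      filter_upwards [hmin] with k hk
      rw [cost_eq_meanSq, cost_eq_meanSq] at hk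
      have e1 : ∀ t, stack (n k) y - M.pred (fun i : Fin (n k) => x i) t =
          stack (n k) e - (D t k - S k) := by
        intro t
        have : stack (n k) y = S k + stack (n k) e := by
          funext s; simp only [stack, S, Pi.add_apply, hy]; rfl
        rw [this]
        simp only [D]
        abel
      rwa [e1, e1] at hk)
  refine (tendsto_meanSq_sub (tendsto_meanSq_sub hd hr) hs).congr fun k => ?_
  congr 1
  simp only [D]
  abel

/-! ### Identification of the limit -/

/-- Equivalent parameters give the same predictions on data of full rank, since the cost vanishes
when the outputs are the predictions. -/
lemma CostEquiv.pred_eq {θ₁ θ₂ : Par p q} (h : M.CostEquiv θ₁ θ₂) {N : ℕ}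
    {z : Fin N → Reg na nb ny nu} (hz : (M.Phi z).rank = p) : M.pred z θ₁ = M.pred z θ₂ := by
  have h1 := h N z (fun i => WithLp.toLp 2 fun j => M.pred z θ₂ (i, j)) hz
  have h2 : M.cost z (fun i => WithLp.toLp 2 fun j => M.pred z θ₂ (i, j)) θ₂ = 0 := by
    simp [cost]
  rw [h2, cost] at h1
  funext s
  have hN : (N : ℝ)⁻¹ ≠ 0 := inv_ne_zero (Nat.cast_ne_zero.2 (by
    rintro rfl; exact s.1.elim0))
  have h3 := (mul_eq_zero.1 h1).resolve_left hN
  rw [Finset.sum_eq_zero_iff_of_nonneg fun _ _ => sq_nonneg _] at h3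
  have h4 := h3 s (Finset.mem_univ _)
  exact (sub_eq_zero.1 (pow_eq_zero_iff two_ne_zero |>.1 h4)).symm

/-- On data of full rank, equal predictions mean equal baseline parameters, and learning
components that differ by a baseline function. -/
lemma eq_of_pred_eq {N : ℕ} {z : Fin N → Reg na nb ny nu} (hz : (M.Phi z).rank = p)
    {θ₁ θ₂ : Par p q} (h : M.pred z θ₁ = M.pred z θ₂) :
    θ₁.1 = θ₂.1 ∧ ∃ v : Vec p, M.F z θ₁.2 - M.F z θ₂.2 = M.Phi z *ᵥ v.ofLp := by
  have hu := isUnit_det_gram (rank_eq_iff_injective.1 hz)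
  have hl : ∀ θ : Par p q, lsq (M.Phi z) (M.pred z θ) = θ.1 := fun θ => by
    rw [pred, lsq_add, lsq_sub, lsq_mulVec hu, lsq_mulVec hu, thetaAux_eq_lsq, sub_self, add_zero]
  have h1 : θ₁.1 = θ₂.1 := by rw [← hl θ₁, ← hl θ₂, h]
  refine ⟨h1, M.thetaAux z θ₁.2 - M.thetaAux z θ₂.2, ?_⟩
  rw [pred, pred, h1, add_right_inj, sub_eq_sub_iff_sub_eq_sub] at h
  rw [h, WithLp.ofLp_sub, Matrix.mulVec_sub]

/-- Equivalent parameters have equal baseline parts, and their learning components differ by one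
baseline function, on all of the regressor space: adding a regressor to data of full rank does not
change the coefficients of the difference. -/
lemma CostEquiv.eq_and_learn_eq {θ₁ θ₂ : Par p q} (h : M.CostEquiv θ₁ θ₂)
    (hz : ∃ (N : ℕ) (z : Fin N → Reg na nb ny nu), (M.Phi z).rank = p) :
    θ₁.1 = θ₂.1 ∧ ∃ v : Vec p, ∀ w, M.learn θ₁.2 w = M.learn θ₂.2 w + M.base v w := by
  obtain ⟨N, z, hz⟩ := hz
  obtain ⟨h1, v, hv⟩ := eq_of_pred_eq hz (h.pred_eq hz)
  refine ⟨h1, v, fun w => ?_⟩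
  have hinj := rank_eq_iff_injective.1 hz
  have hz' : (M.Phi (Fin.cons w z : Fin (N + 1) → Reg na nb ny nu)).rank = p := by
    refine rank_eq_iff_injective.2 fun a b hab => hinj ?_
    funext s
    exact congrFun hab (s.1.succ, s.2)
  obtain ⟨-, v', hv'⟩ := eq_of_pred_eq hz' (h.pred_eq hz')
  have hvv : v = v' := by
    refine WithLp.ofLp_injective 2 (hinj ?_)
    change M.Phi z *ᵥ v.ofLp = M.Phi z *ᵥ v'.ofLp
    rw [← hv]
    funext s
    exact congrFun hv' (s.1.succ, s.2)
  ext j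
  have h2 := congrFun hv' (0, j)
  rw [← hvv] at h2
  have h3 : M.learn θ₁.2 w j - M.learn θ₂.2 w j = M.base v w j := h2
  rw [PiLp.add_apply]
  linarith

/-- Shifting the learning component by a baseline function shifts the auxiliary parameter. -/
lemma thetaAux_shift {N : ℕ} {z : Fin N → Reg na nb ny nu} (hz : IsUnit ((M.Phi z)ᵀ * M.Phi z).det)
    {a₁ a₂ : Vec q} {v : Vec p} (h : ∀ w, M.learn a₁ w = M.learn a₂ w + M.base v w) :
    M.thetaAux z a₁ = M.thetaAux z a₂ + v := by
  have : M.F z a₁ = M.F z a₂ + M.Phi z *ᵥ v.ofLp := by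
    funext s
    simp only [F, Pi.add_apply, h]
    rfl
  rw [thetaAux_eq_lsq, thetaAux_eq_lsq, this, lsq_add, lsq_mulVec hz]

/-- The baseline part of a parameter of the true system is `bstar`, by the orthogonality of the
unmodeled terms and of the least-squares residual to the baseline. -/
lemma Typical.eq_of_true (h : M.Typical Θ x e) (hpred : M.StablePredictor Θ)
    {θ : Par p q} (hθ : θ ∈ Θ) {c bstar : Vec p} {δ : Reg na nb ny nu → Vec ny}
    (haux : Tendsto (fun N : ℕ => M.thetaAux (fun i : Fin N => x i) θ.2) atTop (𝓝 c))
    (htrue : ∀ z, M.osa θ c z = M.base bstar z + δ z)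
    (horth : Tendsto (fun N : ℕ => (N : ℝ)⁻¹ • ∑ i ∈ Finset.range N,
      (M.phi (x i))ᵀ *ᵥ (δ (x i)).ofLp) atTop (𝓝 0)) : θ.1 = bstar := by
  obtain ⟨B, hB, hx⟩ := h.power
  obtain ⟨κ, hκ, hexc⟩ := h.excited
  obtain ⟨C, hC, hgrow⟩ := hpred.base_growth ⟨θ, hθ⟩
  have hbase : ∀ (N : ℕ) (b : Vec p), meanSq (M.Phi (fun i : Fin N => x i) *ᵥ b.ofLp) ≤
      2 * C ^ 2 * (1 + B) * ‖b‖ ^ 2 := fun N b => meanSq_base_le hB hx hgrow N b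
  set d := θ.1 - bstar with hd
  let A : ∀ N, Matrix (Fin N × Fin ny) (Fin p) ℝ := fun N => M.Phi fun i : Fin N => x i
  let a : ℕ → Vec p := fun N => M.thetaAux (fun i : Fin N => x i) θ.2
  have h1 : Tendsto (fun N => meanIP (A N *ᵥ d.ofLp) (stack N fun i => δ (x i))) atTop (𝓝 0) := by
    have hcont : Continuous fun v : Fin p → ℝ => d.ofLp ⬝ᵥ v := by
      unfold dotProduct; fun_prop
    have := (hcont.tendsto 0).comp horth
    rw [dotProduct_zero] at this
    refine this.congr fun N => ?_
    simp only [Function.comp, A]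
    rw [Phi_mulVec, meanIP_stack, dotProduct_smul, dotProduct_sum, ← Finset.mul_sum,
      Finset.sum_comm, smul_eq_mul]
    congr 1
    refine Finset.sum_congr rfl fun i _ => ?_
    rw [Matrix.dotProduct_mulVec, Matrix.vecMul_transpose]
    rfl
  have h2 : Tendsto (fun N => meanIP (A N *ᵥ d.ofLp) (A N *ᵥ (a N - c).ofLp)) atTop (𝓝 0) := by
    refine tendsto_meanIP_of_bounded (n := fun N => N) (fun N => hbase N d)
      (tendsto_meanSq_of_le (n := fun N => N) (Eventually.of_forall fun N => hbase N (a N - c)) ?_)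
    have h3 := tendsto_iff_norm_sub_tendsto_zero.1 haux
    simpa using (h3.pow 2).const_mul (2 * C ^ 2 * (1 + B))
  have h3 : Tendsto (fun N => meanSq (A N *ᵥ d.ofLp)) atTop (𝓝 0) := by
    have h4 := h1.sub h2
    rw [sub_zero] at h4
    refine h4.congr' ?_
    filter_upwards [h.eventually_isUnit] with N hN
    have e1 : (stack N fun i => δ (x i)) = A N *ᵥ d.ofLp +
        ((M.F (fun i : Fin N => x i) θ.2 - A N *ᵥ (a N).ofLp) + A N *ᵥ (a N - c).ofLp) := by
      have e2 : (stack N fun i => δ (x i)) =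
          stack N (fun i => M.osa θ c (x i)) - A N *ᵥ bstar.ofLp := by
        simp only [A]
        rw [Phi_mulVec]
        funext s
        simp only [stack, htrue, Pi.sub_apply, PiLp.add_apply]
        ring
      rw [e2, stack_osa_eq, stack_osa, WithLp.ofLp_sub, WithLp.ofLp_sub, Matrix.mulVec_sub,
        Matrix.mulVec_sub]
      simp only [A]
      abel
    have e3 : meanIP (A N *ᵥ d.ofLp) (M.F (fun i : Fin N => x i) θ.2 - A N *ᵥ (a N).ofLp) = 0 := by
      have := mulVec_dotProduct_sub_lsq hN (M.F (fun i : Fin N => x i) θ.2) d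
      unfold meanIP
      rw [dotProduct] at this
      simp only [A, a, thetaAux_eq_lsq]
      rw [this, mul_zero]
    rw [e1, meanIP_add_right, meanIP_add_right, e3, meanIP_self]
    ring
  have h4 : κ * ‖d‖ ^ 2 ≤ 0 := ge_of_tendsto h3 (hexc.mono fun N hN => hN d)
  have h5 : ‖d‖ ^ 2 = 0 := by nlinarith [sq_nonneg ‖d‖]
  have h6 : d = 0 := by simpa using h5
  exact sub_eq_zero.1 h6

lemma continuousOn_cost (hpred : M.StablePredictor Θ) {N : ℕ} (z : Fin N → Reg na nb ny nu)
    (y : Fin N → Vec ny) : ContinuousOn (M.cost z y) Θ := by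
  intro θ hθ
  refine ContinuousAt.continuousWithinAt ?_
  have hF : ContinuousAt (fun t : Par p q => M.F z t.2) θ := by
    refine continuousAt_pi.2 fun s => ?_
    have := hpred.continuousAt_learn hθ (z s.1)
    unfold F
    fun_prop
  have hA : ∀ (m : Type) [Fintype m] (B : Matrix m (Fin N × Fin ny) ℝ),
      ContinuousAt (fun t : Par p q => B *ᵥ M.F z t.2) θ := fun m _ B =>
    (Continuous.matrix_mulVec continuous_const continuous_id).continuousAt.comp hF
  have hp : ContinuousAt (M.pred z) θ := by
    have e1 : M.pred z = fun t => M.Phi z *ᵥ t.1.ofLp + (M.F z t.2 -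
        (M.Phi z * (((M.Phi z)ᵀ * M.Phi z)⁻¹ * (M.Phi z)ᵀ)) *ᵥ M.F z t.2) := by
      funext t
      simp only [pred, thetaAux, Matrix.mulVec_mulVec]
    rw [e1]
    refine ContinuousAt.add ?_ (hF.sub (hA _ _))
    have : Continuous fun t : Par p q => M.Phi z *ᵥ t.1.ofLp := by fun_prop
    exact this.continuousAt
  have hp' : ∀ s, ContinuousAt (fun t => M.pred z t s) θ := fun s => continuousAt_pi.1 hp s
  unfold cost
  refine continuousAt_const.mul (tendsto_finsetSum _ fun s _ => ?_)
  exact (continuousAt_const.sub (hp' s)).pow 2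

end Components

/-! ### White noise and its past -/

section Noise

variable {Ω : Type*} [m0 : MeasurableSpace Ω] {P : Measure Ω} {ny : ℕ}
  {e : ℕ → Ω → Vec ny}

lemma WhiteNoise.memLp_two (he : WhiteNoise P e) (k : ℕ) : MemLp (e k) 2 P :=
  (he.ident k).memLp_iff.2 he.memLp

lemma WhiteNoise.average_power (he : WhiteNoise P e) :
    ∀ᵐ ω ∂P, ∃ B : ℝ, ∀ N : ℕ, ∑ k ∈ Finset.range N, ‖e k ω‖ ^ 2 ≤ B * N := by
  have hm : Measurable fun v : Vec ny => ‖v‖ ^ 2 := by fun_prop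
  have h := strong_law_ae_real (fun k ω => ‖e k ω‖ ^ 2) he.memLp.norm.integrable_sq
    (fun i j hij => (he.indep.indepFun hij).comp hm hm) (fun k => (he.ident k).comp hm)
  filter_upwards [h] with ω hω
  obtain ⟨B, hB⟩ := hω.bddAbove_range
  refine ⟨B, fun N => ?_⟩
  rcases Nat.eq_zero_or_pos N with rfl | hN
  · simp
  · have h1 := hB ⟨N, rfl⟩
    simp only at h1
    rwa [div_le_iff₀ (by exact_mod_cast hN)] at h1

variable [IsProbabilityMeasure P]

/-- Initial data `Z` together with the noise before time `n`. -/
def past {α : Type*} (Z : Ω → α) (e : ℕ → Ω → Vec ny) (n : ℕ) (ω : Ω) : α × (ℕ → Vec ny) :=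
  (Z ω, fun k => if k < n then e k ω else 0)

variable {α : Type*} [MeasurableSpace α] {Z : Ω → α}

lemma measurable_truncate (n : ℕ) :
    Measurable fun (s : ℕ → Vec ny) (k : ℕ) => if k < n then s k else 0 := by
  refine measurable_pi_iff.2 fun k => ?_
  split_ifs
  · exact measurable_pi_apply k
  · exact measurable_const

lemma measurable_past (hZ : Measurable Z) (he : ∀ k, Measurable (e k)) (n : ℕ) :
    Measurable (past Z e n) :=
  hZ.prodMk ((measurable_truncate n).comp (measurable_pi_iff.2 he))

/-- The filtration of the past: what is known before the noise at time `n` acts. -/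
def pastFiltration (hZ : Measurable Z) (he : ∀ k, Measurable (e k)) : Filtration ℕ m0 where
  seq n := MeasurableSpace.comap (past Z e n) inferInstance
  mono' m n hmn := by
    have h1 : past Z e m = (fun t : α × (ℕ → Vec ny) =>
        (t.1, fun k => if k < m then t.2 k else 0)) ∘ past Z e n := by
      funext ω
      simp only [past, Function.comp, Prod.mk.injEq, true_and]
      funext k
      by_cases hk : k < m
      · simp [hk, hk.trans_le hmn]
      · simp [hk]
    have h2 : Measurable (fun t : α × (ℕ → Vec ny) =>
        (t.1, fun k => if k < m then t.2 k else 0)) :=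
      measurable_fst.prodMk ((measurable_truncate m).comp measurable_snd)
    change MeasurableSpace.comap (past Z e m) inferInstance ≤ _
    rw [h1, ← MeasurableSpace.comap_comp]
    exact MeasurableSpace.comap_mono h2.comap_le
  le' n := (measurable_past hZ he n).comap_le

variable {hZ : Measurable Z} {hem : ∀ k, Measurable (e k)}

lemma measurable_past_self (n : ℕ) : Measurable[pastFiltration hZ hem n] (past Z e n) :=
  comap_measurable _

lemma measurable_initial (n : ℕ) : Measurable[pastFiltration hZ hem n] Z :=
  measurable_fst.comp (measurable_past_self (hZ := hZ) (hem := hem) n)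

lemma measurable_noise (n : ℕ) : Measurable[pastFiltration hZ hem (n + 1)] (e n) := by
  have h := (measurable_pi_apply n).comp
    (measurable_snd.comp (measurable_past_self (hZ := hZ) (hem := hem) (n + 1)))
  have e1 : (fun b : ℕ → Vec ny => b n) ∘ Prod.snd ∘ past Z e (n + 1) = e n := by
    funext ω; simp [past]
  rwa [e1] at h

lemma WhiteNoise.indep_past (he : WhiteNoise P e) (hind : IndepFun Z (fun ω k => e k ω) P) (n : ℕ)
    (j : Fin ny) : Indep (pastFiltration hZ he.meas n)
      (MeasurableSpace.comap (fun ω => e n ω j) inferInstance) P := by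
  have h1 : IndepFun Z (fun ω => ((fun k => if k < n then e k ω else 0), e n ω)) P :=
    hind.comp (φ := id) (ψ := fun s : ℕ → Vec ny => ((fun k => if k < n then s k else 0), s n))
      measurable_id ((measurable_truncate n).prodMk (measurable_pi_apply n))
  have h2 : IndepFun (fun ω k => if k < n then e k ω else 0) (e n) P := by
    have h3 := he.indep.indepFun_finset (Finset.range n) {n} (by simp) he.meas
    have h4 : Measurable fun (s : Finset.range n → Vec ny) (k : ℕ) =>
        if h : k < n then s ⟨k, Finset.mem_range.2 h⟩ else 0 := by
      refine measurable_pi_iff.2 fun k => ?_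
      split_ifs
      · exact measurable_pi_apply _
      · exact measurable_const
    have h5 : Measurable fun s : ({n} : Finset ℕ) → Vec ny => s ⟨n, Finset.mem_singleton_self n⟩ :=
      measurable_pi_apply _
    have h6 := h3.comp h4 h5
    have e1 : (fun ω k => if k < n then e k ω else 0) =
        (fun (s : Finset.range n → Vec ny) (k : ℕ) =>
          if h : k < n then s ⟨k, Finset.mem_range.2 h⟩ else 0) ∘
        fun ω (i : Finset.range n) => e i ω := by
      funext ω k
      simp
    rw [e1]
    exact h6
  have h7 := indepFun_prodMk_left hZ
    ((measurable_truncate n).comp (measurable_pi_iff.2 he.meas)) (he.meas n) h1 h2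
  have h8 := (IndepFun_iff_Indep _ _ _).1 h7
  refine indep_of_indep_of_le_right h8 ?_
  have h9 : Measurable fun v : Vec ny => v j := by fun_prop
  exact (h9.comp (comap_measurable (e n))).comap_le

/-- White noise is asymptotically orthogonal to every signal of finite average power that is
determined by the past. -/
lemma WhiteNoise.tendsto_meanIP (he : WhiteNoise P e) (hind : IndepFun Z (fun ω k => e k ω) P)
    {g : ℕ → Ω → Vec ny} (hg : ∀ n, Measurable[pastFiltration hZ he.meas n] (g n))
    (hpow : ∀ᵐ ω ∂P, ∃ B : ℝ, ∀ N : ℕ, ∑ i ∈ Finset.range N, ‖g i ω‖ ^ 2 ≤ B * N) :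
    ∀ᵐ ω ∂P, Tendsto (fun N => meanIP (stack N fun i => e i ω) (stack N fun i => g i ω))
      atTop (𝓝 0) := by
  have hcoord : ∀ j : Fin ny, Measurable fun v : Vec ny => v j := fun j => by fun_prop
  have key : ∀ j : Fin ny, ∀ᵐ ω ∂P, Tendsto (fun N : ℕ => (N : ℝ)⁻¹ *
      ∑ i ∈ Finset.range N, e i ω j * g i ω j) atTop (𝓝 0) := by
    intro j
    have hid : ∀ n, IdentDistrib (fun ω => e n ω j) (fun ω => e 0 ω j) P P := fun n =>
      (he.ident n).comp (hcoord j)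
    have hL : ∀ n, MemLp (fun ω => e n ω j) 2 P := fun n =>
      (he.memLp_two n).of_le ((hcoord j).comp (he.meas n)).aestronglyMeasurable
        (Eventually.of_forall fun ω => PiLp.norm_apply_le (e n ω) j)
    refine ae_tendsto_average_transform (pastFiltration hZ he.meas)
      (σ2 := ∫ ω, e 0 ω j ^ 2 ∂P)
      (fun n => (hcoord j).comp (measurable_noise n)) (fun n => (hcoord j).comp (hg n))
      (fun n => he.indep_past hind n j) hL (fun n => ?_) (fun n => ?_) ?_
    · rw [(hid n).integral_eq]
      have h1 := (EuclideanSpace.proj j : Vec ny →L[ℝ] ℝ).integral_comp_comm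
        (he.memLp.integrable one_le_two)
      rw [he.mean, map_zero] at h1
      exact h1
    · exact ((hid n).comp (measurable_id.pow_const 2)).integral_eq.le
    · filter_upwards [hpow] with ω ⟨B, hB⟩
      refine ⟨B, fun N => (Finset.sum_le_sum fun i _ => ?_).trans (hB N)⟩
      rw [← sq_abs, ← Real.norm_eq_abs]
      exact pow_le_pow_left₀ (norm_nonneg _) (PiLp.norm_apply_le (g i ω) j) 2
  filter_upwards [ae_all_iff.2 key] with ω hω
  simp_rw [meanIP_stack]
  rw [show (0 : ℝ) = ∑ _j : Fin ny, 0 by simp]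
  exact tendsto_finsetSum _ fun j _ => hω j

end Noise

/-! ### Almost every realization is typical -/

namespace Components

lemma measurable_dataReg {Ω : Type*} {m : MeasurableSpace Ω} {na nb ny nu : ℕ} {u : ℤ → Ω → Vec nu}
    {y : ℤ → Ω → Vec ny} (n : ℕ)
    (hy : ∀ k : ℤ, -(na : ℤ) ≤ k → k < n → Measurable[m] (y k)) (hu : ∀ k, Measurable[m] (u k)) :
    Measurable[m] fun ω => dataReg na nb y u ω n := by
  refine (PiLp.continuous_toLp 2 _).measurable.comp (measurable_pi_iff.2 fun s => ?_)
  rcases s with s | s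
  · have h : Measurable fun v : Vec ny => v s.2 := by fun_prop
    have := s.1.isLt
    exact h.comp (hy _ (by omega) (by omega))
  · have h : Measurable fun v : Vec nu => v s.2 := by fun_prop
    exact h.comp (hu _)

variable {Ω : Type*} [m0 : MeasurableSpace Ω] {P : Measure Ω} [IsProbabilityMeasure P]
  {na nb ny nu p q : ℕ} {M : Components na nb ny nu p q} {Θ : Set (Par p q)}

/-- The law of large numbers extends from a dense set of parameters, by equicontinuity. -/
lemma tendsto_meanIP_osa_of_dense (hpred : M.StablePredictor Θ) {T : Set (Par p q)}
    (hT : Θ ⊆ closure T) {x : ℕ → Reg na nb ny nu} {e : ℕ → Vec ny} {B Be : ℝ} (hB : 0 ≤ B)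
    (hx : ∀ N : ℕ, ∑ i ∈ Finset.range N, ‖x i‖ ^ 2 ≤ B * N)
    (he : ∀ N : ℕ, meanSq (stack N e) ≤ Be)
    (hlaw : ∀ θ ∈ T, Tendsto (fun N => meanIP (stack N e) (stack N fun i => M.osa θ 0 (x i)))
      atTop (𝓝 0)) {θ : Par p q} (hθ : θ ∈ Θ) :
    Tendsto (fun N => meanIP (stack N e) (stack N fun i => M.osa θ 0 (x i))) atTop (𝓝 0) := by
  have hBe : 0 ≤ Be := (meanSq_nonneg _).trans (he 0)
  refine Metric.tendsto_nhds.2 fun a ha => ?_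
  have hε : 0 < √(a ^ 2 / (8 * (Be + 1) * (1 + B))) := Real.sqrt_pos.2 (by positivity)
  obtain ⟨r, hr, heq⟩ := hpred.osa_equicontinuous hθ hε
  obtain ⟨θ', hθ', hd⟩ := Metric.mem_closure_iff.1 (hT hθ) r hr
  rw [dist_comm] at hd
  filter_upwards [Metric.tendsto_nhds.1 (hlaw θ' hθ') (a / 2) (half_pos ha)] with N hN
  rw [Real.dist_eq, sub_zero] at hN ⊢
  have h1 := meanSq_stack_le_of_growth hB hx
      (g := fun i => M.osa θ' 0 (x i) - M.osa θ 0 (x i)) (fun i => heq _ hd (x i)) N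
  rw [Real.sq_sqrt (by positivity)] at h1
  have h2 := abs_meanIP_le (stack N e) (stack N fun i => M.osa θ' 0 (x i) - M.osa θ 0 (x i))
  have h3 : √(meanSq (stack N e) * meanSq (stack N fun i => M.osa θ' 0 (x i) - M.osa θ 0 (x i)))
      ≤ a / 2 := by
    refine Real.sqrt_le_iff.2 ⟨by positivity, ?_⟩
    calc _ ≤ (Be + 1) * (2 * (a ^ 2 / (8 * (Be + 1) * (1 + B))) * (1 + B)) :=
          mul_le_mul ((he N).trans (by linarith)) h1 (meanSq_nonneg _) (by positivity)
      _ = (a / 2) ^ 2 := by field_simp; ring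
  have e1 : (stack N fun i => M.osa θ' 0 (x i) - M.osa θ 0 (x i)) =
      (stack N fun i => M.osa θ' 0 (x i)) - stack N fun i => M.osa θ 0 (x i) := rfl
  rw [e1] at h3
  rw [e1, meanIP_sub_right] at h2
  have h4 := abs_sub_abs_le_abs_sub (meanIP (stack N e) (stack N fun i => M.osa θ 0 (x i)))
    (meanIP (stack N e) (stack N fun i => M.osa θ' 0 (x i)))
  rw [abs_sub_comm] at h4
  linarith

variable {bstar : Vec p} {δ : Reg na nb ny nu → Vec ny} {u : ℤ → Ω → Vec nu} {e : ℕ → Ω → Vec ny}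
  {y : ℤ → Ω → Vec ny}

/-- Almost every realization is typical. Here `θ₀` and `c` witness that the true system is a stable
predictor, from which its Lipschitz continuity and measurability are inherited. -/
theorem ae_typical (hΘ : IsCompact Θ) (he : WhiteNoise P e) (hu : QuasiStationary P u)
    (hpow : FiniteAveragePower P u) (hy0 : ∀ k : ℤ, k < 0 → Measurable (y k))
    (hindep : IndepFun (fun ω => ((fun k : ℤ => u k ω), (fun j : Fin na => y (-1 - (j : ℤ)) ω)))
      (fun ω => (fun k : ℕ => e k ω)) P)
    (hy : ∀ (k : ℕ) (ω : Ω), y (k : ℤ) ω =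
      M.base bstar (dataReg na nb y u ω k) + δ (dataReg na nb y u ω k) + e k ω)
    (hsys : StableSystem P (fun x => M.base bstar x + δ x) u e)
    (hpred : M.StablePredictor Θ) (hid : M.BaselineIdentifiable) (hbase : M.BaselineExcited P y u)
    {θ₀ : Par p q} (hθ₀ : θ₀ ∈ Θ) {c : Vec p}
    (htrue : ∀ x, M.osa θ₀ c x = M.base bstar x + δ x) :
    ∀ᵐ ω ∂P, M.Typical Θ (fun k => dataReg na nb y u ω k) fun k => e k ω := by
  set f : Reg na nb ny nu → Vec ny := fun x => M.base bstar x + δ x with hf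
  have hcont : ∀ {g : Reg na nb ny nu → Vec ny},
      (∃ L : ℝ, 0 ≤ L ∧ ∀ x x', ‖g x - g x'‖ ≤ L * ‖x - x'‖) → Measurable g := by
    rintro g ⟨L, hL, h⟩
    refine (LipschitzWith.of_dist_le_mul (K := ⟨L, hL⟩) fun x x' => ?_).continuous.measurable
    rw [dist_eq_norm, dist_eq_norm]
    exact h x x'
  have hfL : ∃ L : ℝ, 0 ≤ L ∧ ∀ x x', ‖f x - f x'‖ ≤ L * ‖x - x'‖ := by
    obtain ⟨L, hL, h⟩ := hpred.osa_lipschitz hθ₀ c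
    refine ⟨L, hL, fun x x' => ?_⟩
    simp only [hf, ← htrue]
    exact h x x'
  have hfm : Measurable f := hcont hfL
  -- the regressors have finite average power
  have hrec : ∀ ω (k : ℕ), dataReg na nb y u ω (k + 1) = nextReg (dataReg na nb y u ω k)
      (f (dataReg na nb y u ω k) + e k ω) (u ((k + 1 : ℕ) : ℤ) ω) := by
    intro ω k
    have h1 := reg_succ (na := na) (nb := nb) (fun i => y i ω) (fun i => u i ω) k
    have h2 : f (dataReg na nb y u ω k) + e k ω = y k ω := (hy k ω).symm
    rw [h2]
    unfold dataReg
    push_cast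
    exact h1
  have hxpow : ∀ᵐ ω ∂P, ∃ B : ℝ, 0 ≤ B ∧
      ∀ N : ℕ, ∑ i ∈ Finset.range N, ‖dataReg na nb y u ω i‖ ^ 2 ≤ B * N := by
    obtain ⟨L, hL, hfL⟩ := hfL
    filter_upwards [hpow, he.average_power] with ω h1 h2
    obtain ⟨B, hB⟩ := hsys.average_power hL hfL hfm hu.meas he.meas
      (fun k => (hu.memLp k).integrable one_le_two)
      (fun k => (he.memLp_two k).integrable one_le_two)
      (x := fun k => dataReg na nb y u ω k) (v := fun k => u (k : ℤ) ω) (w := fun k => e k ω)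
      (hrec ω) h1 h2
    refine ⟨B, ?_, hB⟩
    have := hB 1
    simp only [Finset.sum_range_one, Nat.cast_one, mul_one] at this
    exact (sq_nonneg _).trans this
  -- the regressors are determined by the past
  have hZ : Measurable fun ω => ((fun k : ℤ => u k ω), (fun j : Fin na => y (-1 - (j : ℤ)) ω)) :=
    (measurable_pi_iff.2 hu.meas).prodMk (measurable_pi_iff.2 fun j => hy0 _ (by omega))
  set 𝓕 := pastFiltration hZ he.meas with hF
  have hu𝓕 : ∀ n k, Measurable[𝓕 n] (u k) := fun n k =>
    (measurable_pi_apply k).comp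
      (measurable_fst.comp (measurable_initial (hZ := hZ) (hem := he.meas) n))
  have hy𝓕 : ∀ n : ℕ, ∀ k : ℤ, -(na : ℤ) ≤ k → k < n → Measurable[𝓕 n] (y k) := by
    intro n
    induction n with
    | zero =>
      intro k h1 h2
      have h3 : (-1 - k).toNat < na := by omega
      have h4 : -1 - (((⟨(-1 - k).toNat, h3⟩ : Fin na) : ℕ) : ℤ) = k := by simp only; omega
      have h5 := (measurable_pi_apply (⟨(-1 - k).toNat, h3⟩ : Fin na)).comp
        (measurable_snd.comp (measurable_initial (hZ := hZ) (hem := he.meas) 0))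
      rw [← h4]
      exact h5
    | succ n ih =>
      intro k h1 h2
      by_cases hk : k < n
      · exact (ih k h1 hk).mono (𝓕.mono (Nat.le_succ n)) le_rfl
      · have h3 : k = n := by push_cast at h2; omega
        have h4 : y k = fun ω => f (dataReg na nb y u ω n) + e n ω := by
          rw [h3]; funext ω; exact hy n ω
        rw [h4]
        exact ((hfm.comp (measurable_dataReg n ih (hu𝓕 n))).mono
          (𝓕.mono (Nat.le_succ n)) le_rfl).add (measurable_noise n)
  have hx𝓕 : ∀ n, Measurable[𝓕 n] fun ω => dataReg na nb y u ω n := fun n =>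
    measurable_dataReg n (hy𝓕 n) (hu𝓕 n)
  have hlaw : ∀ g : Reg na nb ny nu → Vec ny, Measurable g →
      (∃ C : ℝ, 0 ≤ C ∧ ∀ x, ‖g x‖ ≤ C * (1 + ‖x‖)) →
      ∀ᵐ ω ∂P, Tendsto (fun N => meanIP (stack N fun i => e i ω)
        (stack N fun i => g (dataReg na nb y u ω i))) atTop (𝓝 0) := by
    rintro g hg ⟨C, hC, hgr⟩
    refine he.tendsto_meanIP hindep (hZ := hZ) (g := fun n ω => g (dataReg na nb y u ω n))
      (fun n => hg.comp (hx𝓕 n)) ?_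
    filter_upwards [hxpow] with ω ⟨B, hB, hx⟩
    refine ⟨2 * C ^ 2 * (1 + B), fun N => ?_⟩
    have h1 := meanSq_stack_le_of_growth hB hx (g := fun i => g (dataReg na nb y u ω i))
      (fun i => hgr _) N
    rw [meanSq_stack] at h1
    rcases Nat.eq_zero_or_pos N with rfl | hN
    · simp
    · rwa [inv_mul_le_iff₀ (by exact_mod_cast hN), mul_comm] at h1
  obtain ⟨C, hC, hgrow⟩ := hpred.base_growth ⟨θ₀, hθ₀⟩
  obtain ⟨T, hTΘ, hTc, hT⟩ := hΘ.isSeparable.exists_countable_dense_subset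
  have hlawT := (ae_ball_iff hTc).2 fun θ hθ => hlaw (M.osa θ 0)
    (hcont (hpred.osa_lipschitz (hTΘ hθ) 0)) (hpred.osa_growth (hTΘ hθ) 0)
  have hlawb := ae_all_iff.2 fun l : Fin p => hlaw (M.base (EuclideanSpace.single l (1 : ℝ)))
    (hcont (hpred.base_lipschitz ⟨θ₀, hθ₀⟩ _)) ⟨C, hC, fun x => by
      simpa using hgrow (EuclideanSpace.single l (1 : ℝ)) x⟩
  filter_upwards [hxpow, he.average_power, hlawT, hlawb, hbase] with ω ⟨B, hB, hx⟩ ⟨Be, hBe⟩ h1 h2 h3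
  have hBe0 : 0 ≤ Be := by
    have := hBe 1
    simp only [Finset.sum_range_one, Nat.cast_one, mul_one] at this
    exact (sq_nonneg _).trans this
  have hnoise : ∀ N, meanSq (stack N fun k => e k ω) ≤ Be := meanSq_stack_le_of_power hBe0 hBe
  refine ⟨⟨B, hB, hx⟩, ⟨Be, hnoise⟩,
    fun θ hθ => tendsto_meanIP_osa_of_dense hpred hT hB hx hnoise h1 hθ, h2,
    exists_uniform_excitation hB hx hgrow fun b hb => ?_⟩
  have hne : ∃ x, M.base b x ≠ M.base 0 x := by
    by_contra hcon
    push Not at hcon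
    exact hb (hid b 0 hcon)
  obtain ⟨c, hc, h4⟩ := h3 b 0 hne
  refine ⟨c, hc, h4.mono fun N hN => ?_⟩
  rw [Phi_mulVec, meanSq_stack]
  have : ∀ x, M.base 0 x = 0 := fun x => by simp [base]
  simpa only [this, sub_zero] using hN

/-- A parameter that is equivalent to a true one is true. -/
lemma CostEquiv.mem_trueSet
    (htyp : ∀ᵐ ω ∂P, M.Typical Θ (fun k => dataReg na nb y u ω k) fun k => e k ω)
    {θ θ₀ : Par p q} (h : M.CostEquiv θ θ₀) (hθ : θ ∈ Θ) (hθ₀ : θ₀ ∈ M.trueSet P Θ y u bstar δ) :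
    θ ∈ M.trueSet P Θ y u bstar δ := by
  obtain ⟨-, c, haux, htrue⟩ := hθ₀
  obtain ⟨ω, hω⟩ := htyp.exists
  obtain ⟨h1, v, hv⟩ := h.eq_and_learn_eq hω.exists_rank_eq
  refine ⟨hθ, c + v, ?_, fun z => ?_⟩
  · filter_upwards [htyp, haux] with ω h2 h3
    refine (h3.add_const v).congr' ?_
    filter_upwards [h2.eventually_isUnit] with N hN
    exact (thetaAux_shift hN hv).symm
  · rw [← htrue, osa, osa, hv, base_add, h1]
    abel

end Components

end OrthAug

theorem theorem3 {Ω : Type*} [MeasurableSpace Ω] (P : Measure Ω) [IsProbabilityMeasure P]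
    {na nb ny nu p q : ℕ} (M : OrthAug.Components na nb ny nu p q)
    (Θ : Set (OrthAug.Par p q)) (hΘ : IsCompact Θ)
    (bstar : OrthAug.Vec p) (δ : OrthAug.Reg na nb ny nu → OrthAug.Vec ny)
    (u : ℤ → Ω → OrthAug.Vec nu) (e : ℕ → Ω → OrthAug.Vec ny) (y : ℤ → Ω → OrthAug.Vec ny)
    -- white noise, quasi-stationary input, initial outputs; input and initial data independent
    -- of the noise
    (he : OrthAug.WhiteNoise P e)
    (hu : OrthAug.QuasiStationary P u)
    (hpow : OrthAug.FiniteAveragePower P u)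
    (hy0 : ∀ k : ℤ, k < 0 → Measurable (y k))
    (hindep : IndepFun (fun ω => ((fun k : ℤ => u k ω), (fun j : Fin na => y (-1 - (j : ℤ)) ω)))
      (fun ω => (fun k : ℕ => e k ω)) P)
    -- data-generating system
    (hy : ∀ (k : ℕ) (ω : Ω), y (k : ℤ) ω =
      M.base bstar (OrthAug.dataReg na nb y u ω k) + δ (OrthAug.dataReg na nb y u ω k) + e k ω)
    (hsys : OrthAug.StableSystem P (fun x => M.base bstar x + δ x) u e)
    (hpred : M.StablePredictor Θ)
    (hid : M.BaselineIdentifiable)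
    (hbase : M.BaselineExcited P y u)
    (hmod : M.ModelsExcited P Θ y u)
    (horth : M.DataOrthogonal P y u δ)
    (hne : (M.trueSet P Θ y u bstar δ).Nonempty) :
    ∀ᵐ ω ∂P,
      (∀ N : ℕ, (M.argminSet Θ y u N ω).Nonempty) ∧
      ∀ θhat : ℕ → OrthAug.Par p q, (∀ᶠ N : ℕ in atTop, θhat N ∈ M.argminSet Θ y u N ω) →
        Tendsto (fun N => Metric.infDist (θhat N) (M.trueSet P Θ y u bstar δ)) atTop (𝓝 0) ∧
        Tendsto (fun N => (θhat N).1) atTop (𝓝 bstar) := by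
  obtain ⟨θ₀, hθ₀⟩ := hne
  obtain ⟨hθ₀Θ, c, haux, htrue⟩ := id hθ₀
  have htyp := OrthAug.Components.ae_typical hΘ he hu hpow hy0 hindep hy hsys hpred hid hbase hθ₀Θ htrue
  have hb : ∀ θ ∈ M.trueSet P Θ y u bstar δ, θ.1 = bstar := by
    rintro θ ⟨hθ, c', haux', htrue'⟩
    obtain ⟨ω, h1, h2, h3⟩ := (htyp.and (haux'.and horth)).exists
    exact h1.eq_of_true hpred hθ h2 htrue' h3
  filter_upwards [htyp, haux, hmod] with ω h1 h2 h3
  refine ⟨fun N => ?_, fun θhat hhat => ?_⟩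
  · obtain ⟨θ, hθ, hmin⟩ := hΘ.exists_isMinOn ⟨θ₀, hθ₀Θ⟩ (OrthAug.Components.continuousOn_cost hpred _ _)
    exact ⟨θ, hθ, fun θ' hθ' => hmin hθ'⟩
  have hdist : Tendsto (fun N => Metric.infDist (θhat N) (M.trueSet P Θ y u bstar δ))
      atTop (𝓝 0) := by
    refine tendsto_of_subseq_tendsto fun ns hns => ?_
    obtain ⟨θ, hθ, ms, hms, hlim⟩ := hΘ.tendsto_subseq'
      ((hns.eventually hhat).mono fun k hk => hk.1).frequently
    have hn : Tendsto (fun k => ns (ms k)) atTop atTop := hns.comp hms.tendsto_atTop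
    have hpredeq := h1.tendsto_meanSq_pred_sub hpred hθ₀Θ h2 (y := fun k => y k ω)
      (fun i => by rw [htrue]; exact hy i ω) hn hθ hlim
      ((hn.eventually hhat).mono fun k hk => hk.2 θ₀ hθ₀Θ)
    -- the limit is equivalent to the true parameter, since otherwise the data tell them apart
    have hequiv : M.CostEquiv θ θ₀ := by
      by_contra hcon
      obtain ⟨a, ha, h4⟩ := h3 θ hθ θ₀ hθ₀Θ hcon
      exact absurd (ge_of_tendsto hpredeq (hn.eventually h4)) (not_le.2 ha)
    have hmem := hequiv.mem_trueSet htyp hθ hθ₀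
    refine ⟨ms, ?_⟩
    have h5 := ((Metric.continuous_infDist_pt (M.trueSet P Θ y u bstar δ)).tendsto θ).comp hlim
    rwa [Metric.infDist_zero_of_mem hmem] at h5
  refine ⟨hdist, tendsto_iff_dist_tendsto_zero.2 (squeeze_zero (fun _ => dist_nonneg)
    (fun N => ?_) hdist)⟩
  refine (Metric.le_infDist ⟨θ₀, hθ₀⟩).2 fun t ht => ?_
  rw [← hb t ht]
  exact le_max_left _ _
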